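/- Let $K$ be a field of characteristic zero (for instance $\mathbb{Q}$ or $\mathbb{C}$) and let $\omega$ be the exponent of square matrix multiplication over $K$, i.e. the minimal real number $\tau$ such that for every $\varepsilon>0$ the product of two $n\times n$ matrices over $K$ can be computed by an algebraic (bilinear) algorithm of rank $O(n^{\tau+\varepsilon})$. Consider the congested clique with $n$ nodes: in each synchronous round every node can send to each node a (possibly different) message of $\lceil\log_2 n\rceil$ bits, and local computation is free. Let $M$ be an integer with $1\le M\le n$. The input is an undirected graph on $n$ vertices whose edges have integer weights in $\{0,\ldots,M\}$, where node $\ell$ initially knows the $\ell$-th row (equivalently, the $\ell$-th column) of the adjacency matrix, whose entries are the edge weights, with $\infty$ for non-adjacent pairs. The diameter is the maximum, over all pairs of vertices, of the smallest total weight of a walk joining them; it is $\infty$ if the graph is disconnected. Then the deterministic round complexity of computing the diameter (every node outputs it) is $\tilde O(M^{2/\omega}n^{1-2/\omega})$, where, as usual, the $o(1)$ in the exponent $\omega$ is ignored. Precisely: there is a constant $c$ such that for every $\varepsilon>0$ there is a constant $C$ such that, for all integers $1\le M\le n$, there is a deterministic congested clique algorithm that computes the diameter of every such graph in at most $$C\,M^{2/(\omega+\varepsilon)}\,n^{1-2/(\omega+\varepsilon)}\,(\log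 n)^{c}$$ rounds. -/

import Mathlib

namespace CongestedClique

/-! ### Algebraic algorithms and the exponent of matrix multiplication -/

/-- An algebraic (bilinear) algorithm of rank `t` over the field `K` for the product of an
`n × m` matrix by an `m × n` matrix: coefficient families `α`, `β`, `lam` such that
`(A * B) i j = ∑ μ, lam i j μ * S μ * T μ`, where `S μ` is the linear form in the entries of `A`
with coefficients `α · · μ` and `T μ` is the linear form in the entries of `B` with coefficients
`β · · μ`. -/
structure AlgebraicAlgorithm (K : Type*) [Field K] (n m t : ℕ) where
  α : Fin n → Fin m → Fin t → K
  β : Fin n → Fin m → Fin t → K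
  lam : Fin n → Fin n → Fin t → K
  correct : ∀ (A : Matrix (Fin n) (Fin m) K) (B : Matrix (Fin m) (Fin n) K) (i j : Fin n),
    (A * B) i j =
      ∑ μ : Fin t, lam i j μ *
        (∑ i' : Fin n, ∑ j' : Fin m, α i' j' μ * A i' j') *
        (∑ i' : Fin n, ∑ j' : Fin m, β i' j' μ * B j' i')

/-- The real numbers `τ` such that, for every `ε > 0`, the product of two `n × n` matrices over `K`
can be computed by an algebraic algorithm of rank `O(n ^ (τ + ε))`. -/
def admissibleExponents (K : Type*) [Field K] : Set ℝ :=
  {τ | ∀ ε : ℝ, 0 < ε → ∃ C : ℝ, ∀ n : ℕ, 1 ≤ n →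
    ∃ t : ℕ, (t : ℝ) ≤ C * (n : ℝ) ^ (τ + ε) ∧ Nonempty (AlgebraicAlgorithm K n n t)}

/-- The exponent `ω` of square matrix multiplication over `K`. The infimum is a minimum of a
nonempty set of reals that is bounded below. -/
noncomputable def matMulExponent (K : Type*) [Field K] : ℝ :=
  sInf (admissibleExponents K)

/-! ### Weighted graphs and the diameter -/

/-- An undirected graph on the vertex set `Fin n` with integer edge weights in `{0, …, M}`. The
values of `weight` at non-adjacent pairs are irrelevant. -/
structure WeightedGraph (n M : ℕ) where
  graph : SimpleGraph (Fin n)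
  weight : Fin n → Fin n → ℕ
  weight_symm : ∀ u v, graph.Adj u v → weight u v = weight v u
  weight_le : ∀ u v, graph.Adj u v → weight u v ≤ M

namespace WeightedGraph

variable {n M : ℕ} (G : WeightedGraph n M)

/-- The total weight of a walk. -/
def walkLength {u v : Fin n} (p : G.graph.Walk u v) : ℕ :=
  (p.darts.map fun d => G.weight d.fst d.snd).sum

/-- The weighted distance; it is `⊤` if there is no walk from `u` to `v`. -/
noncomputable def dist (u v : Fin n) : ℕ∞ :=
  ⨅ p : G.graph.Walk u v, (G.walkLength p : ℕ∞)

/-- The diameter, i.e. the largest distance; it is `⊤` if the graph is disconnected. -/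
noncomputable def diameter : ℕ∞ :=
  ⨆ (u : Fin n) (v : Fin n), G.dist u v

open Classical in
/-- The adjacency matrix: the weight of the edge `uv` if there is one, and `⊤` otherwise. -/
noncomputable def adjMatrix (u v : Fin n) : ℕ∞ :=
  if G.graph.Adj u v then (G.weight u v : ℕ∞) else ⊤

end WeightedGraph

/-! ### The congested clique -/

/-- Messages of `b` bits. -/
abbrev Message (b : ℕ) : Type := Fin b → Bool

/-- A deterministic algorithm for the congested clique with `n` nodes and `b`-bit messages, where
each node receives an input in `I` and produces an output in `O`. Computation proceeds in
synchronous rounds and local computation is unrestricted. What a node sends in a round, possibly a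
different message to each node, is a function of its identifier, its own input and the messages
that it received in the earlier rounds (the entry of the list at position `s` holds the messages
received in round `s`, indexed by the sender). Its output is a function of the same data after
the last round. -/
structure Protocol (n b : ℕ) (I O : Type) where
  rounds : ℕ
  send : Fin n → I → List (Fin n → Message b) → Fin n → Message b
  output : Fin n → I → List (Fin n → Message b) → O

namespace Protocol

variable {n b : ℕ} {I O : Type} (P : Protocol n b I O)

/-- The messages received by node `i` during the first `t` rounds when node `j` has input `x j`. -/
def received (x : Fin n → I) : ℕ → Fin n → List (Fin n → Message b)
  | 0, _ => []
  | t + 1, i => received x t i ++ [fun j => P.send j (x j) (received x t j) i]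

/-- The output of node `i` when node `j` has input `x j`. -/
def result (x : Fin n → I) (i : Fin n) : O :=
  P.output i (x i) (P.received x P.rounds i)

end Protocol

/-- The protocol computes the diameter of undirected graphs with `n` vertices and weights in
`{0, …, M}`: on every such graph, if each node `i` is initially given row `i` of the adjacency
matrix (which is also its column `i`, since the matrix is symmetric), then at the end every node
outputs the diameter. -/
def ComputesDiameter {n b : ℕ} (M : ℕ) (P : Protocol n b (Fin n → ℕ∞) ℕ∞) : Prop :=
  ∀ (G : WeightedGraph n M) (i : Fin n), P.result (fun j => G.adjMatrix j) i = G.diameter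

end CongestedClique

/-! The core is one distributed min-plus product of matrices with entries in {0, …, W} ∪ {⊤}, W =
4M. Encode a as X^a and ⊤ as 0. In the ordinary matrix product the coefficient of X^c counts the
middle vertices that give the sum c, so the min-plus entry is the least exponent with a nonzero
coefficient (`leastExponent_sum`). The degree is at most 2W, so 2W + 1 matrix products over `ZMod
p`, one per evaluation point, determine it; p > 9n keeps the points distinct and the counts nonzero.
Apply a d × d scheme of rank t with tM ≤ n to blocks of side e ≈ n/d. This leaves O(Mt) = O(n)
products of e × e matrices, hence O(1) per node, and routing O(e²) words per node takes O(n/d²)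
rounds up to the word length (`computes_minPlus`). With d^σ ≈ n/M this is M^(2/σ) n^(1-2/σ).

Schemes over K must be moved to `ZMod p`. The coefficients of one scheme generate a finitely
generated ℚ-algebra, which maps to a number field by Zariski's lemma; restriction of scalars brings
the scheme to ℚ at the price of a constant factor in the rank, which a tensor power absorbs
(`exists_rat_scheme`). One rational scheme has only finitely many bad primes, and its tensor powers
are formed after reduction, so the choice of primes does not depend on the power.

Distances can be as large as nM, but entries must stay O(M). So only windows of distances near a
centre T are kept. Since a shortest walk can be cut anywhere with an overshoot of at most M, the
product of the windows at S and T gives the window at S + T (`window_add_eq`). Doubling yields the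
centres 2^j M, and a binary search over sums of these brings the centre within M below the diameter.
This takes O(log n) products. -/

namespace CongestedClique

/-! ### Protocols: composition and direct exchange -/

/-- Some protocol with `R` rounds of `b`-bit messages computes `f`. -/
def Computes (n b R : ℕ) {I O : Type} (f : (Fin n → I) → Fin n → O) : Prop :=
  ∃ P : Protocol n b I O, P.rounds = R ∧ ∀ x i, P.result x i = f x i

namespace Protocol

variable {n b : ℕ} {I O : Type} (P : Protocol n b I O)

@[simp] theorem length_received (x : Fin n → I) (t : ℕ) (i : Fin n) :
    (P.received x t i).length = t := by
  induction t with
  | zero => rfl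
  | succ t ih => simp [received, ih]

end Protocol

namespace Computes

variable {n b : ℕ}

theorem congr {R R' : ℕ} {I O : Type} {f g : (Fin n → I) → Fin n → O} (h : Computes n b R f)
    (hR : R = R') (hfg : ∀ x i, f x i = g x i) : Computes n b R' g := by
  obtain ⟨P, h1, h2⟩ := h
  exact ⟨P, h1.trans hR, fun x i => (h2 x i).trans (hfg x i)⟩

theorem local_map {I O : Type} (g : Fin n → I → O) :
    Computes n b 0 (fun (x : Fin n → I) i => g i (x i)) :=
  ⟨⟨0, fun _ _ _ _ _ => false, fun i s _ => g i s⟩, rfl, fun _ _ => rfl⟩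

/-- Local pre- and postprocessing is free. -/
theorem lift {R : ℕ} {I O S S' : Type} {f : (Fin n → I) → Fin n → O} (h : Computes n b R f)
    (pre : Fin n → S → I) (post : Fin n → S → O → S') :
    Computes n b R (fun (x : Fin n → S) i => post i (x i) (f (fun j => pre j (x j)) i)) := by
  obtain ⟨P, h1, h2⟩ := h
  let Q : Protocol n b S S' :=
    ⟨P.rounds, fun i s l => P.send i (pre i s) l, fun i s l => post i s (P.output i (pre i s) l)⟩
  have key : ∀ (x : Fin n → S) t i, Q.received x t i = P.received (fun j => pre j (x j)) t i := by
    intro x t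
    induction t with
    | zero => intro i; rfl
    | succ t ih => intro i; simp only [Protocol.received, ih]; rfl
  refine ⟨Q, h1, fun x i => ?_⟩
  change Q.result x i = post i (x i) (f (fun j => pre j (x j)) i)
  rw [← h2]
  simp only [Protocol.result, key]
  rfl

theorem comp {R₁ R₂ : ℕ} {I J O : Type} {f : (Fin n → I) → Fin n → J} {g : (Fin n → J) → Fin n → O}
    (hg : Computes n b R₂ g) (hf : Computes n b R₁ f) :
    Computes n b (R₁ + R₂) (fun x => g (f x)) := by
  obtain ⟨P, rfl, h2⟩ := hf
  obtain ⟨Q, rfl, h4⟩ := hg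
  let S : Protocol n b I O :=
    ⟨P.rounds + Q.rounds,
      -- The length of the transcript is the round number. In the second phase a node recomputes its
      -- input for `Q` from the first part of the transcript.
      fun i s l => if l.length < P.rounds then P.send i s l
        else Q.send i (P.output i s (l.take P.rounds)) (l.drop P.rounds),
      fun i s l => Q.output i (P.output i s (l.take P.rounds)) (l.drop P.rounds)⟩
  have key1 : ∀ (x : Fin n → I) t, t ≤ P.rounds → ∀ i, S.received x t i = P.received x t i := by
    intro x t
    induction t with
    | zero => intro _ i; rfl
    | succ t ih =>
      intro ht i
      have ht' : t < P.rounds := ht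
      simp only [Protocol.received, ih ht'.le]
      simp [S, ht']
  have key2 : ∀ (x : Fin n → I) t i, S.received x (P.rounds + t) i =
      P.received x P.rounds i ++ Q.received (f x) t i := by
    intro x t
    induction t with
    | zero => intro i; simp [key1 x _ le_rfl, Protocol.received]
    | succ t ih =>
      intro i
      rw [← add_assoc]
      simp only [Protocol.received, ih]
      rw [List.append_assoc]
      congr 2
      have hj : ∀ j, P.output j (x j) (P.received x P.rounds j) = f x j := h2 x
      simp [S, hj]
  refine ⟨S, rfl, fun x i => ?_⟩
  change S.result x i = g (f x) i
  rw [← h4]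
  have hi : P.output i (x i) (P.received x P.rounds i) = f x i := h2 x i
  change Q.output i (P.output i (x i) ((S.received x (P.rounds + Q.rounds) i).take P.rounds))
    ((S.received x (P.rounds + Q.rounds) i).drop P.rounds) = _
  rw [key2]
  simp [hi, Protocol.result]

theorem iterate {R : ℕ} {I : Type} {f : (Fin n → I) → Fin n → I} (h : Computes n b R f) (m : ℕ) :
    Computes n b (m * R) (f^[m]) := by
  induction m with
  | zero => exact (local_map (fun _ s => s)).congr (by simp) (fun _ _ => rfl)
  | succ m ih =>
    refine (comp ih h).congr (by ring) (fun x i => ?_)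
    simp

/-- Every node sends to each node a value of a type with at most `2 ^ (b * w)` elements. -/
theorem exchange {I V : Type} [Fintype V] [Nonempty V] {w : ℕ} (hV : Fintype.card V ≤ 2 ^ (b * w))
    (msg : Fin n → I → Fin n → V) :
    Computes n b w (fun (x : Fin n → I) i j => msg j (x j) i) := by
  have hcard : Fintype.card V ≤ Fintype.card (Fin w → Message b) := by
    simpa [Message, pow_mul] using hV
  obtain ⟨enc⟩ := Function.Embedding.nonempty_of_card_le hcard
  let P : Protocol n b I (Fin n → V) :=
    ⟨w, fun j s l i => if h : l.length < w then enc (msg j s i) ⟨l.length, h⟩ else fun _ => false,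
      fun _ _ l j => Function.invFun enc
        (fun s : Fin w => ((l[(s : ℕ)]?).getD (fun _ _ => false)) j)⟩
  have key : ∀ (x : Fin n → I) i t, t ≤ w → ∀ s (hs : s < t) (hs' : s < w),
      (P.received x t i)[s]? = some (fun j => enc (msg j (x j) i) ⟨s, hs'⟩) := by
    intro x i t
    induction t with
    | zero => intro _ s hs; omega
    | succ t ih =>
      intro ht s hs hs'
      rw [Protocol.received]
      rcases Nat.lt_succ_iff_lt_or_eq.1 hs with h | h
      · rw [List.getElem?_append_left (by simpa using h)]
        exact ih (by omega) s h hs'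
      · subst h
        rw [List.getElem?_append_right (by simp)]
        simp only [Protocol.length_received, Nat.sub_self, List.getElem?_cons_zero,
          Option.some.injEq]
        funext j
        simp [P, hs']
  refine ⟨P, rfl, fun x i => ?_⟩
  funext j
  change Function.invFun enc
    (fun s : Fin w => (((P.received x w i)[(s : ℕ)]?).getD (fun _ _ => false)) j) = _
  have : (fun s : Fin w => (((P.received x w i)[(s : ℕ)]?).getD (fun _ _ => false)) j) =
      enc (msg j (x j) i) := by
    funext s
    rw [key x i w le_rfl s s.2 s.2]
    rfl
  rw [this]
  exact Function.leftInverse_invFun enc.injective _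

end Computes

/-! ### Routing along a fixed pattern -/

/-- Greedy edge colouring of a bipartite multigraph. -/
theorem exists_edge_coloring {E X C : Type} [Fintype E] [Fintype C] [DecidableEq X]
    (src dst : E → X) (L : ℕ)
    (hs : ∀ v, (Finset.univ.filter (fun e => src e = v)).card ≤ L)
    (hd : ∀ v, (Finset.univ.filter (fun e => dst e = v)).card ≤ L)
    (hC : 2 * L ≤ Fintype.card C) :
    ∃ c : E → C, (∀ e e', src e = src e' → c e = c e' → e = e') ∧
      (∀ e e', dst e = dst e' → c e = c e' → e = e') := by
  classical
  have main : ∀ A : Finset E, ∃ c : E → C,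
      (∀ e ∈ A, ∀ e' ∈ A, src e = src e' → c e = c e' → e = e') ∧
      (∀ e ∈ A, ∀ e' ∈ A, dst e = dst e' → c e = c e' → e = e') := by
    intro A
    induction A using Finset.induction_on with
    | empty =>
      rcases isEmpty_or_nonempty E with h | ⟨⟨e⟩⟩
      · exact ⟨fun e => (h.false e).elim, by simp, by simp⟩
      · have : 0 < L := lt_of_lt_of_le
          (Finset.card_pos.2 ⟨e, by simp⟩) (hs (src e))
        have : 0 < Fintype.card C := by omega
        obtain ⟨c⟩ := Fintype.card_pos_iff.1 this
        exact ⟨fun _ => c, by simp, by simp⟩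
    | insert a A ha ih =>
      obtain ⟨c, h1, h2⟩ := ih
      let B := (Finset.univ.filter (fun e => src e = src a)).erase a ∪
        (Finset.univ.filter (fun e => dst e = dst a)).erase a
      have hB : (B.image c).card < Fintype.card C := by
        have e1 := Finset.card_erase_lt_of_mem
          (show a ∈ Finset.univ.filter (fun e => src e = src a) by simp)
        have e2 := Finset.card_erase_lt_of_mem
          (show a ∈ Finset.univ.filter (fun e => dst e = dst a) by simp)
        have e3 := hs (src a)
        have e4 := hd (dst a)
        have e5 : (B.image c).card ≤ B.card := Finset.card_image_le
        have e6 : B.card ≤ _ := Finset.card_union_le _ _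
        omega
      obtain ⟨k, hk⟩ : ∃ k, k ∉ B.image c := by
        by_contra! h
        have := Finset.card_le_card (show Finset.univ ⊆ B.image c from fun k _ => h k)
        rw [Finset.card_univ] at this
        omega
      have hk' : ∀ e ∈ A, (src e = src a ∨ dst e = dst a) → c e ≠ k := by
        intro e he hea hck
        apply hk
        refine Finset.mem_image.2 ⟨e, ?_, hck⟩
        have : e ≠ a := fun h => ha (h ▸ he)
        simpa [B, this] using hea
      refine ⟨Function.update c a k, ?_, ?_⟩
      · intro e he e' he' hee hc
        by_cases h : e = a <;> by_cases h' : e' = a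
        · rw [h, h']
        · subst h
          have := Finset.mem_of_mem_insert_of_ne he' h'
          rw [Function.update_self, Function.update_of_ne h'] at hc
          exact (hk' e' this (Or.inl hee.symm) hc.symm).elim
        · subst h'
          have := Finset.mem_of_mem_insert_of_ne he h
          rw [Function.update_self, Function.update_of_ne h] at hc
          exact (hk' e this (Or.inl hee) hc).elim
        · rw [Function.update_of_ne h, Function.update_of_ne h'] at hc
          exact h1 e (Finset.mem_of_mem_insert_of_ne he h) e'
            (Finset.mem_of_mem_insert_of_ne he' h') hee hc
      · intro e he e' he' hee hc
        by_cases h : e = a <;> by_cases h' : e' = a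
        · rw [h, h']
        · subst h
          have := Finset.mem_of_mem_insert_of_ne he' h'
          rw [Function.update_self, Function.update_of_ne h'] at hc
          exact (hk' e' this (Or.inr hee.symm) hc.symm).elim
        · subst h'
          have := Finset.mem_of_mem_insert_of_ne he h
          rw [Function.update_self, Function.update_of_ne h] at hc
          exact (hk' e this (Or.inr hee) hc).elim
        · rw [Function.update_of_ne h, Function.update_of_ne h'] at hc
          exact h2 e (Finset.mem_of_mem_insert_of_ne he h) e'
            (Finset.mem_of_mem_insert_of_ne he' h') hee hc
  obtain ⟨c, h1, h2⟩ := main Finset.univ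
  exact ⟨c, fun e e' => h1 e (Finset.mem_univ _) e' (Finset.mem_univ _),
    fun e e' => h2 e (Finset.mem_univ _) e' (Finset.mem_univ _)⟩

open Classical in
/-- Routing along a fixed pattern: each item `e` travels from `src e` to `dst e`. -/
theorem Computes.route {n b w r L : ℕ} {I E V : Type} [Fintype E] [Fintype V] [Inhabited V]
    (hV : Fintype.card V ≤ 2 ^ (b * w)) (src dst : E → Fin n)
    (hs : ∀ v, (Finset.univ.filter (fun e => src e = v)).card ≤ L)
    (hd : ∀ v, (Finset.univ.filter (fun e => dst e = v)).card ≤ L)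
    (hL : 2 * L ≤ n * r) (val : E → I → V) :
    Computes n b (2 * (w * r)) (fun (x : Fin n → I) i (e : E) =>
      if dst e = i then val e (x (src e)) else default) := by
  -- A colour (k, q) sends the item through relay k in slot q. Properness at sources and at
  -- destinations means that no slot is used twice on either leg, and all nodes know the colouring
  -- since the pattern is fixed.
  obtain ⟨c, hc1, hc2⟩ := exists_edge_coloring (C := Fin n × Fin r) src dst L hs hd (by simpa using hL)
  have hV' : Fintype.card (Fin r → V) ≤ 2 ^ (b * (w * r)) := by
    rw [Fintype.card_fun, Fintype.card_fin, ← mul_assoc, pow_mul]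
    exact Nat.pow_le_pow_left hV r
  have st1 := Computes.exchange (n := n) (I := I) hV' (fun j s k q =>
    if h : ∃ e, src e = j ∧ c e = (k, q) then val h.choose s else default)
  have st2 := Computes.exchange (n := n) (I := Fin n → Fin r → V) hV' (fun k s i q =>
    if h : ∃ e, dst e = i ∧ c e = (k, q) then s (src h.choose) q else default)
  have st3 := Computes.local_map (n := n) (b := b) (I := Fin n → Fin r → V) (fun i s (e : E) =>
    if dst e = i then s (c e).1 (c e).2 else default)
  refine (st3.comp (st2.comp st1)).congr (by ring) (fun x i => ?_)
  funext e
  by_cases h : dst e = i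
  · simp only [h, if_true]
    have h2 : ∃ e', dst e' = i ∧ c e' = ((c e).1, (c e).2) := ⟨e, h, rfl⟩
    have e2 : h2.choose = e := hc2 _ _ (h2.choose_spec.1.trans h.symm) h2.choose_spec.2
    rw [dif_pos h2, e2]
    have h1 : ∃ e', src e' = src e ∧ c e' = ((c e).1, (c e).2) := ⟨e, rfl, rfl⟩
    have e1 : h1.choose = e := hc1 _ _ h1.choose_spec.1 h1.choose_spec.2
    rw [dif_pos h1, e1]
  · simp [h]

/-! ### Bilinear schemes and change of the coefficient ring -/

/-- A bilinear scheme for matrix multiplication, given by the Brent equations. -/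
structure Scheme (R ι τ : Type*) [CommRing R] [DecidableEq ι] [Fintype τ] where
  α : ι → ι → τ → R
  β : ι → ι → τ → R
  lam : ι → ι → τ → R
  brent : ∀ i j i' j' k l, ∑ μ, lam i j μ * α i' j' μ * β k l μ =
    if i = i' ∧ j' = l ∧ j = k then 1 else 0

namespace Scheme

variable {R S ι κ τ υ : Type*} [CommRing R] [CommRing S] [DecidableEq ι] [DecidableEq κ]
  [Fintype τ] [Fintype υ]

/-- Transport of a scheme along a ring homomorphism. -/
def map (s : Scheme R ι τ) (f : R →+* S) : Scheme S ι τ where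
  α i j μ := f (s.α i j μ)
  β i j μ := f (s.β i j μ)
  lam i j μ := f (s.lam i j μ)
  brent i j i' j' k l := by
    have := congrArg f (s.brent i j i' j' k l)
    simpa [map_sum, apply_ite f] using this

/-- Reindexing of a scheme. -/
def reindex (s : Scheme R ι τ) (e : κ ≃ ι) (g : υ ≃ τ) : Scheme R κ υ where
  α i j μ := s.α (e i) (e j) (g μ)
  β i j μ := s.β (e i) (e j) (g μ)
  lam i j μ := s.lam (e i) (e j) (g μ)
  brent i j i' j' k l := by
    have := s.brent (e i) (e j) (e i') (e j') (e k) (e l)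
    simp only [EmbeddingLike.apply_eq_iff_eq] at this
    rw [← this]
    exact Fintype.sum_equiv g _ _ (fun _ => rfl)

/-- The tensor product of two schemes. -/
def prod (s : Scheme R ι τ) (s' : Scheme R κ υ) : Scheme R (ι × κ) (τ × υ) where
  α i j μ := s.α i.1 j.1 μ.1 * s'.α i.2 j.2 μ.2
  β i j μ := s.β i.1 j.1 μ.1 * s'.β i.2 j.2 μ.2
  lam i j μ := s.lam i.1 j.1 μ.1 * s'.lam i.2 j.2 μ.2
  brent i j i' j' k l := by
    have h1 := s.brent i.1 j.1 i'.1 j'.1 k.1 l.1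
    have h2 := s'.brent i.2 j.2 i'.2 j'.2 k.2 l.2
    have : ∀ μ : τ × υ, s.lam i.1 j.1 μ.1 * s'.lam i.2 j.2 μ.2 *
        (s.α i'.1 j'.1 μ.1 * s'.α i'.2 j'.2 μ.2) * (s.β k.1 l.1 μ.1 * s'.β k.2 l.2 μ.2) =
        (s.lam i.1 j.1 μ.1 * s.α i'.1 j'.1 μ.1 * s.β k.1 l.1 μ.1) *
        (s'.lam i.2 j.2 μ.2 * s'.α i'.2 j'.2 μ.2 * s'.β k.2 l.2 μ.2) := fun μ => by ring
    simp only [this]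
    rw [Fintype.sum_prod_type]
    dsimp only
    rw [← Fintype.sum_mul_sum, h1, h2, ite_zero_mul_ite_zero, mul_one]
    simp only [Prod.ext_iff]
    congr 1
    apply propext
    tauto

/-- The scheme of rank one for `1 × 1` matrices. -/
def one (R : Type*) [CommRing R] : Scheme R (Fin 1) (Fin 1) where
  α _ _ _ := 1
  β _ _ _ := 1
  lam _ _ _ := 1
  brent i j i' j' k l := by simp [eq_iff_true_of_subsingleton]

theorem exists_pow {m t : ℕ} (s : Scheme R (Fin m) (Fin t)) (r : ℕ) :
    Nonempty (Scheme R (Fin (m ^ r)) (Fin (t ^ r))) := by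
  induction r with
  | zero => exact ⟨one R⟩
  | succ r ih =>
    obtain ⟨s'⟩ := ih
    rw [pow_succ, pow_succ]
    exact ⟨(s'.prod s).reindex finProdFinEquiv.symm finProdFinEquiv.symm⟩

/-- Descent of a scheme along an injective ring homomorphism whose range contains the
coefficients. -/
theorem descend (s : Scheme S ι τ) (f : R →+* S) (hf : Function.Injective f)
    (hα : ∀ i j μ, s.α i j μ ∈ f.range) (hβ : ∀ i j μ, s.β i j μ ∈ f.range)
    (hl : ∀ i j μ, s.lam i j μ ∈ f.range) : Nonempty (Scheme R ι τ) := by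
  choose a ha using hα
  choose b hb using hβ
  choose c hc using hl
  refine ⟨⟨a, b, c, fun i j i' j' k l => hf ?_⟩⟩
  simp only [map_sum, map_mul, ha, hb, hc, s.brent, apply_ite f, map_one, map_zero]

/-- Restriction of scalars from a finite extension. -/
theorem restrictScalars {K L : Type*} [Field K] [Field L] [Algebra K L] [FiniteDimensional K L]
    (s : Scheme L ι τ) :
    Nonempty (Scheme K ι (τ × Fin (Module.finrank K L) × Fin (Module.finrank K L))) := by
  let B := Module.finBasis K L
  -- A K-linear functional with φ 1 = 1 carries the Brent equations to K. Expanding α and β in a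
  -- basis then costs one factor of the degree each.
  obtain ⟨φ, hφ⟩ : ∃ φ : L →ₗ[K] K, φ 1 = 1 := by
    obtain ⟨φ, hφ⟩ := (Algebra.linearMap K L).exists_leftInverse_of_injective
      (LinearMap.ker_eq_bot.2 (algebraMap K L).injective)
    exact ⟨φ, by simpa using LinearMap.congr_fun hφ 1⟩
  refine ⟨⟨fun i j μ => B.repr (s.α i j μ.1) μ.2.1, fun i j μ => B.repr (s.β i j μ.1) μ.2.2,
    fun i j μ => φ (s.lam i j μ.1 * B μ.2.1 * B μ.2.2), fun i j i' j' k l => ?_⟩⟩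
  have h : ∀ μ : τ, ∑ a, ∑ b, φ (s.lam i j μ * B a * B b) * B.repr (s.α i' j' μ) a *
      B.repr (s.β k l μ) b = φ (s.lam i j μ * s.α i' j' μ * s.β k l μ) := by
    intro μ
    conv_rhs => rw [← B.sum_repr (s.α i' j' μ), ← B.sum_repr (s.β k l μ)]
    simp only [Finset.mul_sum, Finset.sum_mul, map_sum]
    rw [Finset.sum_comm]
    refine Finset.sum_congr rfl fun b _ => Finset.sum_congr rfl fun a _ => ?_
    rw [mul_smul_comm, mul_smul_comm, smul_mul_assoc, map_smul, map_smul]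
    simp only [smul_eq_mul]
    ring
  rw [Fintype.sum_prod_type]
  simp only [Fintype.sum_prod_type, h]
  rw [← map_sum, s.brent]
  split_ifs <;> simp [hφ]

/-- Zariski's lemma: a finitely generated algebra over a field has a point over a finite
extension. -/
theorem exists_hom_finite_field.{u, v} (k : Type u) (A : Type v) [Field k] [CommRing A] [Nontrivial A]
    [Algebra k A] [Algebra.FiniteType k A] :
    ∃ (L : Type v) (_ : Field L) (_ : Algebra k L), FiniteDimensional k L ∧ Nonempty (A →+* L) := by
  obtain ⟨I, hI⟩ := Ideal.exists_maximal A
  let F : Field (A ⧸ I) := Ideal.Quotient.field I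
  have : Algebra.FiniteType k (A ⧸ I) :=
    Algebra.FiniteType.of_surjective (Ideal.Quotient.mkₐ k I) (Ideal.Quotient.mkₐ_surjective k I)
  have : Module.Finite k (A ⧸ I) := finite_of_finite_type_of_isJacobsonRing k (A ⧸ I)
  exact ⟨A ⧸ I, F, inferInstance, this, ⟨Ideal.Quotient.mk I⟩⟩

/-- A scheme over a field of characteristic zero specializes to a finite extension of `ℚ`, hence
yields a scheme over `ℚ` whose rank is larger by a constant factor that tensor powers preserve. -/
theorem exists_rat {K : Type*} [Field K] [CharZero K] {m t : ℕ} (s : Scheme K (Fin m) (Fin t)) :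
    ∃ D : ℕ, 0 < D ∧ ∀ r, Nonempty (Scheme ℚ (Fin (m ^ r)) (Fin (t ^ r * (D * D)))) := by
  classical
  let X : Set K := (Set.range fun q : Fin m × Fin m × Fin t => s.α q.1 q.2.1 q.2.2) ∪
    (Set.range fun q : Fin m × Fin m × Fin t => s.β q.1 q.2.1 q.2.2) ∪
    (Set.range fun q : Fin m × Fin m × Fin t => s.lam q.1 q.2.1 q.2.2)
  have hX : X.Finite := ((Set.finite_range _).union (Set.finite_range _)).union (Set.finite_range _)
  let A := Algebra.adjoin ℚ X
  have hA : X ⊆ A := Algebra.subset_adjoin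
  obtain ⟨s₁⟩ : Nonempty (Scheme A (Fin m) (Fin t)) := by
    refine s.descend (A.val : A →+* K) Subtype.val_injective ?_ ?_ ?_
    · exact fun i j μ => ⟨⟨_, hA (Or.inl (Or.inl ⟨(i, j, μ), rfl⟩))⟩, rfl⟩
    · exact fun i j μ => ⟨⟨_, hA (Or.inl (Or.inr ⟨(i, j, μ), rfl⟩))⟩, rfl⟩
    · exact fun i j μ => ⟨⟨_, hA (Or.inr ⟨(i, j, μ), rfl⟩)⟩, rfl⟩
  have : Algebra.FiniteType ℚ A := by
    rw [← Subalgebra.fg_iff_finiteType]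
    exact ⟨hX.toFinset, by simp [A]⟩
  obtain ⟨L, _, _, _, ⟨f⟩⟩ := exists_hom_finite_field ℚ A
  let s₂ := s₁.map f
  refine ⟨Module.finrank ℚ L, Module.finrank_pos, fun r => ?_⟩
  -- The power is taken over L, before the descent, so that the factor for restriction of scalars is
  -- paid only once.
  obtain ⟨s₃⟩ := s₂.exists_pow r
  obtain ⟨s₄⟩ := s₃.restrictScalars (K := ℚ)
  exact ⟨s₄.reindex (Equiv.refl _) (finProdFinEquiv.symm.trans
    ((Equiv.refl _).prodCongr finProdFinEquiv.symm))⟩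

/-- A rational scheme reduces modulo almost all primes. -/
theorem exists_zmod {m t : ℕ} (s : Scheme ℚ (Fin m) (Fin t)) :
    ∃ D : ℕ, ∀ p : ℕ, p.Prime → D < p → Nonempty (Scheme (ZMod p) (Fin m) (Fin t)) := by
  let g : (Fin m × Fin m × Fin t) ⊕ (Fin m × Fin m × Fin t) ⊕ (Fin m × Fin m × Fin t) → ℚ :=
    Sum.elim (fun q => s.α q.1 q.2.1 q.2.2)
      (Sum.elim (fun q => s.β q.1 q.2.1 q.2.2) (fun q => s.lam q.1 q.2.1 q.2.2))
  obtain ⟨d, hd⟩ := IsLocalization.exist_integer_multiples_of_finite (nonZeroDivisors ℤ) g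
  choose z hz using hd
  have hd0 : (d : ℤ) ≠ 0 := nonZeroDivisors.ne_zero d.2
  have hz' : ∀ q, (z q : ℚ) = ((d : ℤ) : ℚ) * g q := by
    intro q
    have := hz q
    simpa [Submonoid.smul_def] using this
  refine ⟨(d : ℤ).natAbs, fun p hp hDp => ?_⟩
  have := Fact.mk hp
  have hdp : ((d : ℤ) : ZMod p) ≠ 0 := by
    intro h
    rw [ZMod.intCast_zmod_eq_zero_iff_dvd] at h
    have := Int.natAbs_dvd_natAbs.2 h
    simp only [Int.natAbs_natCast] at this
    have := Nat.le_of_dvd (Int.natAbs_pos.2 hd0) this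
    omega
  refine ⟨⟨fun i j μ => (z (Sum.inl (i, j, μ)) : ZMod p) / ((d : ℤ) : ZMod p),
    fun i j μ => (z (Sum.inr (Sum.inl (i, j, μ))) : ZMod p) / ((d : ℤ) : ZMod p),
    fun i j μ => (z (Sum.inr (Sum.inr (i, j, μ))) : ZMod p) / ((d : ℤ) : ZMod p),
    fun i j i' j' k l => ?_⟩⟩
  -- Each Brent term has three coefficients, so multiplication by d³ gives an identity of integers,
  -- which can be reduced modulo p.
  have hZ : ∑ μ, z (Sum.inr (Sum.inr (i, j, μ))) * z (Sum.inl (i', j', μ)) *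
      z (Sum.inr (Sum.inl (k, l, μ))) = (d : ℤ) ^ 3 * if i = i' ∧ j' = l ∧ j = k then 1 else 0 := by
    have h := s.brent i j i' j' k l
    have : (((∑ μ, z (Sum.inr (Sum.inr (i, j, μ))) * z (Sum.inl (i', j', μ)) *
      z (Sum.inr (Sum.inl (k, l, μ))) : ℤ)) : ℚ) =
        (((d : ℤ) ^ 3 * if i = i' ∧ j' = l ∧ j = k then 1 else 0 : ℤ) : ℚ) := by
      push_cast
      rw [← h, Finset.mul_sum]
      refine Finset.sum_congr rfl fun μ _ => ?_
      simp only [hz', g, Sum.elim_inl, Sum.elim_inr]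
      ring
    exact_mod_cast this
  have hZp := congrArg (Int.cast : ℤ → ZMod p) hZ
  push_cast at hZp
  have : ∀ a b c : ZMod p, a / ((d : ℤ) : ZMod p) * (b / ((d : ℤ) : ZMod p)) *
      (c / ((d : ℤ) : ZMod p)) = a * b * c / ((d : ℤ) : ZMod p) ^ 3 := by
    intro a b c
    field_simp
  simp only [this]
  rw [← Finset.sum_div, hZp, mul_div_cancel_left₀ _ (pow_ne_zero 3 hdp)]

/-- The scheme of an algebraic algorithm. -/
def ofAlgorithm {K : Type*} [Field K] {m t : ℕ} (a : AlgebraicAlgorithm K m m t) :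
    Scheme K (Fin m) (Fin t) where
  α := a.α
  β := a.β
  lam := a.lam
  brent i j i' j' k l := by
    have h := a.correct (Matrix.single i' j' 1) (Matrix.single l k 1) i j
    have e1 : ∀ μ, ∑ x, ∑ y, a.α x y μ * Matrix.single i' j' (1 : K) x y = a.α i' j' μ := by
      intro μ
      rw [Finset.sum_eq_single i', Finset.sum_eq_single j']
      · simp
      · intro y _ hy; simp [hy.symm]
      · simp
      · intro x _ hx; simp [hx.symm]
      · simp
    have e2 : ∀ μ, ∑ x, ∑ y, a.β x y μ * Matrix.single l k (1 : K) y x = a.β k l μ := by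
      intro μ
      rw [Finset.sum_eq_single k, Finset.sum_eq_single l]
      · simp
      · intro y _ hy; simp [hy.symm]
      · simp
      · intro x _ hx; simp [hx.symm]
      · simp
    simp only [e1, e2] at h
    rw [← h, Matrix.mul_apply]
    by_cases hjl : j' = l
    · subst hjl
      rw [Finset.sum_eq_single j']
      · simp only [Matrix.single_apply, and_true, true_and, mul_ite, mul_one, mul_zero]
        by_cases h1 : i = i' <;> by_cases h2 : j = k <;> simp [h1, h2, eq_comm]
      · intro y _ hy; simp [hy.symm]
      · simp
    · rw [Finset.sum_eq_zero]
      · simp [hjl]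
      · intro y _
        by_cases h1 : j' = y
        · subst h1; simp [Matrix.single_apply, Ne.symm hjl]
        · simp [Matrix.single_apply, h1]

/-- The Brent equations recover each coefficient of a linear combination of the m² forms α, so these
forms are independent in a space of dimension t. -/
theorem sq_le {K : Type*} [Field K] {m t : ℕ} (s : Scheme K (Fin m) (Fin t)) : m ^ 2 ≤ t := by
  have hli : LinearIndependent K (fun q : Fin m × Fin m => (fun μ => s.α q.1 q.2 μ : Fin t → K)) := by
    rw [Fintype.linearIndependent_iff]
    intro g hg q
    have h1 : ∀ μ, ∑ q : Fin m × Fin m, g q * s.α q.1 q.2 μ = 0 := by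
      intro μ
      have := congrFun hg μ
      simpa [Finset.sum_apply] using this
    have h2 : ∑ μ, s.lam q.1 q.1 μ * (∑ q : Fin m × Fin m, g q * s.α q.1 q.2 μ) * s.β q.1 q.2 μ
        = g q := by
      simp only [Finset.mul_sum, Finset.sum_mul]
      rw [Finset.sum_comm]
      have : ∀ q' : Fin m × Fin m, ∑ μ, s.lam q.1 q.1 μ * (g q' * s.α q'.1 q'.2 μ) * s.β q.1 q.2 μ
          = g q' * if q.1 = q'.1 ∧ q'.2 = q.2 ∧ q.1 = q.1 then 1 else 0 := by
        intro q'
        rw [← s.brent, Finset.mul_sum]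
        exact Finset.sum_congr rfl fun μ _ => by ring
      simp only [this]
      rw [Finset.sum_eq_single q]
      · simp
      · intro q' _ hq
        rw [if_neg, mul_zero]
        rintro ⟨h3, h4, -⟩
        exact hq (Prod.ext h3.symm h4)
      · simp
    rw [← h2]
    simp [h1]
  have := hli.fintype_card_le_finrank
  simpa [sq] using this

end Scheme

/-! ### The exponent and a single rational scheme -/

/-- The schoolbook algorithm. -/
theorem exists_schoolbook (K : Type*) [Field K] (n : ℕ) :
    Nonempty (AlgebraicAlgorithm K n n (n * (n * n))) := by
  let e : Fin (n * (n * n)) ≃ Fin n × Fin n × Fin n :=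
    finProdFinEquiv.symm.trans ((Equiv.refl _).prodCongr finProdFinEquiv.symm)
  refine ⟨⟨fun i j μ => if i = (e μ).1 ∧ j = (e μ).2.1 then 1 else 0,
    fun i j μ => if i = (e μ).2.2 ∧ j = (e μ).2.1 then 1 else 0,
    fun i j μ => if i = (e μ).1 ∧ j = (e μ).2.2 then 1 else 0, fun A B i j => ?_⟩⟩
  rw [Fintype.sum_equiv e _ (fun q : Fin n × Fin n × Fin n =>
    (if i = q.1 ∧ j = q.2.2 then 1 else 0) * A q.1 q.2.1 * B q.2.1 q.2.2)]
  · simp [Fintype.sum_prod_type, Matrix.mul_apply, ite_and, Finset.sum_ite_irrel]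
  · intro μ
    have h1 : ∑ x, ∑ y, (if x = (e μ).1 ∧ y = (e μ).2.1 then 1 else 0) * A x y =
        A (e μ).1 (e μ).2.1 := by
      simp [ite_and]
    have h2 : ∑ x, ∑ y, (if x = (e μ).2.2 ∧ y = (e μ).2.1 then 1 else 0) * B y x =
        B (e μ).2.1 (e μ).2.2 := by
      simp [ite_and]
    rw [h1, h2]

theorem exists_rpow_gt (C δ : ℝ) (hδ : 0 < δ) : ∃ n : ℕ, 2 ≤ n ∧ C < (n : ℝ) ^ δ := by
  have h := (tendsto_rpow_atTop hδ).comp tendsto_natCast_atTop_atTop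
  obtain ⟨n, h1, h2⟩ := ((h.eventually_gt_atTop C).and (Filter.eventually_ge_atTop 2)).exists
  exact ⟨n, h2, h1⟩

theorem two_le_of_mem_admissibleExponents {K : Type*} [Field K] {τ : ℝ}
    (h : τ ∈ admissibleExponents K) : 2 ≤ τ := by
  by_contra! hτ
  obtain ⟨C, hC⟩ := h ((2 - τ) / 2) (by linarith)
  obtain ⟨n, hn, hn'⟩ := exists_rpow_gt C ((2 - τ) / 2) (by linarith)
  obtain ⟨t, ht, ⟨a⟩⟩ := hC n (by omega)
  have h1 : ((n ^ 2 : ℕ) : ℝ) ≤ t := by exact_mod_cast (Scheme.ofAlgorithm a).sq_le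
  have hn0 : (0 : ℝ) < n := by exact_mod_cast (by omega : 0 < n)
  have h2 : ((n ^ 2 : ℕ) : ℝ) = (n : ℝ) ^ ((2 - τ) / 2) * (n : ℝ) ^ (τ + (2 - τ) / 2) := by
    rw [← Real.rpow_add hn0, show (2 - τ) / 2 + (τ + (2 - τ) / 2) = ((2 : ℕ) : ℝ) by push_cast; ring,
      Real.rpow_natCast]
    push_cast; rfl
  have h3 : C * (n : ℝ) ^ (τ + (2 - τ) / 2) < (n : ℝ) ^ ((2 - τ) / 2) * (n : ℝ) ^ (τ + (2 - τ) / 2) :=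
    mul_lt_mul_of_pos_right hn' (Real.rpow_pos_of_pos hn0 _)
  linarith

theorem admissibleExponents_nonempty (K : Type*) [Field K] : (admissibleExponents K).Nonempty := by
  refine ⟨3, fun ε hε => ⟨1, fun n hn => ⟨n * (n * n), ?_, exists_schoolbook K n⟩⟩⟩
  have hn1 : (1 : ℝ) ≤ n := by exact_mod_cast hn
  rw [one_mul]
  calc ((n * (n * n) : ℕ) : ℝ) = (n : ℝ) ^ ((3 : ℕ) : ℝ) := by
        rw [Real.rpow_natCast]; push_cast; ring
    _ ≤ _ := Real.rpow_le_rpow_of_exponent_le hn1 (by push_cast; linarith)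

theorem two_le_matMulExponent (K : Type*) [Field K] : 2 ≤ matMulExponent K :=
  le_csInf (admissibleExponents_nonempty K) fun _ => two_le_of_mem_admissibleExponents

/-- The exponent over any field of characteristic zero is attained, up to an arbitrarily small
error, by one rational scheme. -/
theorem exists_rat_scheme (K : Type*) [Field K] [CharZero K] (ε : ℝ) (hε : 0 < ε) :
    ∃ m t : ℕ, 2 ≤ m ∧ (t : ℝ) ≤ (m : ℝ) ^ (matMulExponent K + ε) ∧
      Nonempty (Scheme ℚ (Fin m) (Fin t)) := by
  -- The slack ε is spent in quarters: on approaching the infimum, on the ε in the definition of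
  -- admissibility, on the constant C (beaten by a large m), and on D * D (beaten by a high tensor
  -- power).
  obtain ⟨τ, hτ, hτ'⟩ := exists_lt_of_csInf_lt (admissibleExponents_nonempty K)
    (show matMulExponent K < matMulExponent K + ε / 4 by linarith)
  obtain ⟨C, hC⟩ := hτ (ε / 4) (by linarith)
  obtain ⟨m, hm, hCm⟩ := exists_rpow_gt C (ε / 4) (by linarith)
  obtain ⟨t, ht, ⟨a⟩⟩ := hC m (by omega)
  have hm1 : (1 : ℝ) < m := by exact_mod_cast (by omega : 1 < m)
  have hm0 : (0 : ℝ) < m := by linarith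
  set ω := matMulExponent K
  have ht' : (t : ℝ) ≤ (m : ℝ) ^ (ω + 3 * ε / 4) := by
    refine ht.trans ((mul_le_mul_of_nonneg_right hCm.le (Real.rpow_nonneg hm0.le _)).trans ?_)
    rw [← Real.rpow_add hm0]
    exact Real.rpow_le_rpow_of_exponent_le hm1.le (by linarith)
  obtain ⟨D, hD, hs⟩ := (Scheme.ofAlgorithm a).exists_rat
  obtain ⟨r, hr⟩ := pow_unbounded_of_one_lt ((D : ℝ) * D)
    (Real.one_lt_rpow hm1 (show 0 < ε / 4 by linarith))
  have hm4 : (1 : ℝ) ≤ (m : ℝ) ^ (ε / 4) := Real.one_le_rpow hm1.le (by linarith)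
  have hr' : ((D : ℝ) * D) ≤ ((m : ℝ) ^ (ε / 4)) ^ (r + 1) :=
    hr.le.trans (pow_le_pow_right₀ hm4 (by omega))
  refine ⟨m ^ (r + 1), t ^ (r + 1) * (D * D), ?_, ?_, hs (r + 1)⟩
  · calc 2 ≤ m := hm
      _ = m ^ 1 := (pow_one m).symm
      _ ≤ m ^ (r + 1) := Nat.pow_le_pow_right (by omega) (by omega)
  · push_cast
    calc (t : ℝ) ^ (r + 1) * (D * D)
        ≤ ((m : ℝ) ^ (ω + 3 * ε / 4)) ^ (r + 1) * ((m : ℝ) ^ (ε / 4)) ^ (r + 1) := by gcongr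
      _ = ((m : ℝ) ^ (r + 1)) ^ (ω + ε) := by
        rw [← mul_pow, ← Real.rpow_add hm0, ← Real.rpow_natCast, ← Real.rpow_mul hm0.le,
          ← Real.rpow_natCast, ← Real.rpow_mul hm0.le]
        congr 1; ring

/-! ### Truncated min-plus products by interpolation -/

/-- Values above `W` are replaced by `⊤`. -/
noncomputable def trunc (W : ℕ) (a : ℕ∞) : ℕ∞ := if a ≤ W then a else ⊤

/-- The min-plus product of two matrices that are truncated at `W`. -/
noncomputable def minPlus {ι : Type*} (W : ℕ) (A B : ι → ι → ℕ∞) (u v : ι) : ℕ∞ :=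
  ⨅ w, (trunc W (A u w) + trunc W (B w v))

/-- The finite code of a truncated value. -/
noncomputable def encodeTrunc (W : ℕ) (a : ℕ∞) : Option (Fin (W + 1)) :=
  if a ≤ W then some (Fin.ofNat (W + 1) a.toNat) else none

/-- The value with a given finite code. -/
def decodeTrunc {W : ℕ} (o : Option (Fin (W + 1))) : ℕ∞ := o.elim ⊤ (fun i => ((i : ℕ) : ℕ∞))

theorem decodeTrunc_encodeTrunc (W : ℕ) (a : ℕ∞) : decodeTrunc (encodeTrunc W a) = trunc W a := by
  unfold encodeTrunc trunc
  split_ifs with h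
  · lift a to ℕ using (ne_top_of_le_ne_top (ENat.natCast_ne_top W) h)
    have : a ≤ W := by exact_mod_cast h
    simp [decodeTrunc, Nat.mod_eq_of_lt (Nat.lt_succ_of_le this)]
  · rfl

/-- Finite values are sums of two numbers at most W, so a result can be sent as a code in `Option
(Fin (2 * W + 1))` without loss. -/
theorem trunc_minPlus {ι : Type*} (W : ℕ) (A B : ι → ι → ℕ∞) (u v : ι) :
    trunc (2 * W) (minPlus W A B u v) = minPlus W A B u v := by
  unfold trunc
  split_ifs with h
  · rfl
  · symm
    rw [minPlus, iInf_eq_top]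
    intro w
    have h1 : ¬ (trunc W (A u w) + trunc W (B w v)) ≤ ((2 * W : ℕ) : ℕ∞) := fun h' =>
      h ((iInf_le _ w).trans h')
    by_contra h2
    apply h1
    rw [ENat.add_eq_top, not_or] at h2
    unfold trunc at *
    split_ifs at * with h3 h4
    · push_cast
      rw [two_mul]
      exact add_le_add h3 h4
    all_goals simp at h2

section Interpolation

variable {F : Type*} [Field F]

/-- The monomial that encodes a truncated value, evaluated at a point. -/
def evalCode {W : ℕ} (x : F) (o : Option (Fin (W + 1))) : F := o.elim 0 (fun i => x ^ (i : ℕ))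

/-- The monomial that encodes a truncated value. -/
noncomputable def monoCode (F : Type*) [Field F] {W : ℕ} (o : Option (Fin (W + 1))) :
    Polynomial F :=
  o.elim 0 (fun i => Polynomial.X ^ (i : ℕ))

theorem eval_monoCode {W : ℕ} (x : F) (o : Option (Fin (W + 1))) :
    (monoCode F o).eval x = evalCode x o := by
  cases o <;> simp [monoCode, evalCode]

/-- The least exponent of the interpolation polynomial. -/
noncomputable def leastExponent {k : ℕ} (pt : Fin k → F) (z : Fin k → F) : ℕ∞ :=
  ⨅ (c : ℕ) (_ : (Lagrange.interpolate Finset.univ pt z).coeff c ≠ 0), (c : ℕ∞)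

/-- Interpolation recovers the polynomial because its degree is at most 2W. Its coefficients are
numbers of indices w, hence at most n, and `hn` prevents a positive count from vanishing in F. The
zero polynomial correctly yields ⊤. -/
theorem leastExponent_sum {n W : ℕ} (hn : ∀ m : ℕ, 0 < m → m ≤ n → (m : F) ≠ 0)
    (pt : Fin (2 * W + 1) → F) (hpt : Function.Injective pt)
    (a b : Fin n → Option (Fin (W + 1))) :
    leastExponent pt (fun q => ∑ w, evalCode (pt q) (a w) * evalCode (pt q) (b w)) =
      ⨅ w, (decodeTrunc (a w) + decodeTrunc (b w)) := by
  classical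
  set f : Polynomial F := ∑ w, monoCode F (a w) * monoCode F (b w) with hf
  have hdeg1 : ∀ o : Option (Fin (W + 1)), (monoCode F o).natDegree ≤ W := by
    intro o
    cases o with
    | none => simp [monoCode]
    | some i =>
      simp only [monoCode, Option.elim_some, Polynomial.natDegree_X_pow]
      omega
  have hdeg : f.degree < (Finset.univ : Finset (Fin (2 * W + 1))).card := by
    rw [Finset.card_univ, Fintype.card_fin]
    refine lt_of_le_of_lt (Polynomial.degree_le_of_natDegree_le (n := 2 * W) ?_)
      (by exact_mod_cast Nat.lt_succ_self _)
    refine Polynomial.natDegree_sum_le_of_forall_le _ _ fun w _ => ?_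
    refine Polynomial.natDegree_mul_le.trans ?_
    have := hdeg1 (a w)
    have := hdeg1 (b w)
    omega
  have hint : f = Lagrange.interpolate Finset.univ pt
      (fun q => ∑ w, evalCode (pt q) (a w) * evalCode (pt q) (b w)) := by
    refine Lagrange.eq_interpolate_of_eval_eq _ hpt.injOn hdeg fun q _ => ?_
    simp [hf, Polynomial.eval_finsetSum, eval_monoCode]
  rw [leastExponent, ← hint]
  have hcoeff : ∀ c : ℕ, f.coeff c =
      ((Finset.univ.filter (fun w => decodeTrunc (a w) + decodeTrunc (b w) = (c : ℕ∞))).card : F) := by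
    intro c
    rw [hf, Polynomial.finsetSum_coeff, Finset.card_filter]
    push_cast
    refine Finset.sum_congr rfl fun w _ => ?_
    rcases a w with _ | i <;> rcases b w with _ | j
    · simp [monoCode, decodeTrunc]
    · simp [monoCode, decodeTrunc]
    · simp [monoCode, decodeTrunc]
    · simp only [monoCode, decodeTrunc, Option.elim_some, ← pow_add, Polynomial.coeff_X_pow]
      congr 1
      apply propext
      rw [eq_comm]
      norm_cast
  have hne : ∀ c : ℕ, f.coeff c ≠ 0 ↔ ∃ w, decodeTrunc (a w) + decodeTrunc (b w) = (c : ℕ∞) := by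
    intro c
    rw [hcoeff]
    constructor
    · intro h
      by_contra! h'
      apply h
      rw [Finset.filter_false_of_mem (fun w _ => h' w)]
      simp
    · rintro ⟨w, hw⟩
      refine hn _ (Finset.card_pos.2 ⟨w, by simp [hw]⟩) ?_
      exact (Finset.card_le_univ _).trans (by simp)
  apply le_antisymm
  · refine le_iInf fun w => ?_
    by_cases h : decodeTrunc (a w) + decodeTrunc (b w) = ⊤
    · rw [h]; exact le_top
    · obtain ⟨c, hc⟩ := ENat.ne_top_iff_exists.1 h
      rw [← hc]
      exact iInf₂_le c ((hne c).2 ⟨w, hc.symm⟩)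
  · refine le_iInf₂ fun c hc => ?_
    obtain ⟨w, hw⟩ := (hne c).1 hc
    rw [← hw]
    exact iInf_le _ w

end Interpolation

/-! ### The distributed min-plus product -/

/-- A scheme applied to a matrix that is divided into blocks. -/
theorem Scheme.block_mul {R : Type*} [CommRing R] {n d e t : ℕ} (s : Scheme R (Fin d) (Fin t))
    (blk : Fin n → Fin d × Fin e) (hblk : Function.Injective blk) (A B : Fin n → Fin n → R)
    (u w : Fin n) :
    ∑ μ, s.lam (blk u).1 (blk w).1 μ * ∑ c,
      (∑ p : Fin n × Fin n, if (blk p.1).2 = (blk u).2 ∧ (blk p.2).2 = c then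
        s.α (blk p.1).1 (blk p.2).1 μ * A p.1 p.2 else 0) *
      (∑ p : Fin n × Fin n, if (blk p.1).2 = c ∧ (blk p.2).2 = (blk w).2 then
        s.β (blk p.2).1 (blk p.1).1 μ * B p.1 p.2 else 0) = ∑ v, A u v * B v w := by
  -- The first coordinate of `blk` is the block, the second the position inside it. The Brent
  -- equations match blocks, the conditions match positions, and injectivity of `blk` turns both
  -- into equality of vertices. Unused positions act as zero padding.
  have key : ∀ (c : Fin e) (p p' : Fin n × Fin n), ∑ μ, s.lam (blk u).1 (blk w).1 μ *
      ((if (blk p.1).2 = (blk u).2 ∧ (blk p.2).2 = c then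
        s.α (blk p.1).1 (blk p.2).1 μ * A p.1 p.2 else 0) *
      (if (blk p'.1).2 = c ∧ (blk p'.2).2 = (blk w).2 then
        s.β (blk p'.2).1 (blk p'.1).1 μ * B p'.1 p'.2 else 0)) =
      if p.1 = u then if p'.2 = w then if p'.1 = p.2 then if (blk p.2).2 = c then
        A u p.2 * B p.2 w else 0 else 0 else 0 else 0 := by
    rintro c ⟨u', v⟩ ⟨v', w'⟩
    dsimp only
    by_cases h1 : (blk u').2 = (blk u).2 ∧ (blk v).2 = c
    swap
    · simp only [if_neg h1, zero_mul, mul_zero, Finset.sum_const_zero]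
      split_ifs with h2 h3 h4 h5
      · subst h2; exact (h1 ⟨rfl, h5⟩).elim
      all_goals rfl
    by_cases h2 : (blk v').2 = c ∧ (blk w').2 = (blk w).2
    swap
    · simp only [if_neg h2, mul_zero, Finset.sum_const_zero]
      split_ifs with h3 h4 h5 h6
      · subst h4; subst h5; exact (h2 ⟨h6, rfl⟩).elim
      all_goals rfl
    simp only [if_pos h1, if_pos h2]
    have e1 : ∀ μ, s.lam (blk u).1 (blk w).1 μ * (s.α (blk u').1 (blk v).1 μ * A u' v *
        (s.β (blk w').1 (blk v').1 μ * B v' w')) = (s.lam (blk u).1 (blk w).1 μ *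
        s.α (blk u').1 (blk v).1 μ * s.β (blk w').1 (blk v').1 μ) * (A u' v * B v' w') :=
      fun μ => by ring
    simp only [e1]
    rw [← Finset.sum_mul, s.brent]
    by_cases h3 : u' = u
    · subst h3
      by_cases h4 : w' = w
      · subst h4
        by_cases h5 : v' = v
        · subst h5
          simp [h1.2]
        · have : (blk v).1 ≠ (blk v').1 := fun h =>
            h5 (hblk (Prod.ext h (h1.2.trans h2.1.symm))).symm
          simp [this, h5]
      · have : (blk w).1 ≠ (blk w').1 := fun h => h4 (hblk (Prod.ext h h2.2.symm)).symm
        simp [this, h4]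
    · have : (blk u).1 ≠ (blk u').1 := fun h => h3 (hblk (Prod.ext h h1.1.symm)).symm
      simp [this, h3]
  simp only [Finset.sum_mul_sum]
  simp only [Finset.mul_sum]
  rw [Finset.sum_comm]
  have sw : ∀ c : Fin e, ∑ μ, ∑ p : Fin n × Fin n, ∑ p' : Fin n × Fin n,
      s.lam (blk u).1 (blk w).1 μ *
      ((if (blk p.1).2 = (blk u).2 ∧ (blk p.2).2 = c then
        s.α (blk p.1).1 (blk p.2).1 μ * A p.1 p.2 else 0) *
      (if (blk p'.1).2 = c ∧ (blk p'.2).2 = (blk w).2 then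
        s.β (blk p'.2).1 (blk p'.1).1 μ * B p'.1 p'.2 else 0)) =
      ∑ v, if (blk v).2 = c then A u v * B v w else 0 := by
    intro c
    rw [Finset.sum_comm]
    simp only [Finset.sum_comm (s := (Finset.univ : Finset (Fin t))), key]
    simp [Fintype.sum_prod_type]
  simp only [sw]
  rw [Finset.sum_comm]
  simp

theorem card_fiber_le {E X Z Y : Type*} [Fintype E] [Fintype X] [Fintype Z] [DecidableEq Y]
    (H : X → Y) (φ : E → X × Z) (hφ : Function.Injective φ) {h L : ℕ}
    (hH : ∀ y, (Finset.univ.filter (fun x => H x = y)).card ≤ h) (hL : h * Fintype.card Z ≤ L)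
    (y : Y) : (Finset.univ.filter (fun e => H (φ e).1 = y)).card ≤ L := by
  classical
  refine le_trans ?_ hL
  calc _ ≤ ((Finset.univ.filter (fun x => H x = y)) ×ˢ (Finset.univ : Finset Z)).card := by
        refine Finset.card_le_card_of_injOn φ ?_ hφ.injOn
        intro e he
        simpa using he
    _ ≤ _ := by
        rw [Finset.card_product, Finset.card_univ]
        exact Nat.mul_le_mul_right _ (hH y)

/-- The min-plus product of two matrices that are distributed by rows. -/
theorem computes_minPlus {n b w r L W d e t h g : ℕ} {F : Type} [Field F] [Fintype F]
    (s : Scheme F (Fin d) (Fin t)) (hW : 1 ≤ W)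
    (hn : ∀ m : ℕ, 0 < m → m ≤ n → (m : F) ≠ 0)
    (pt : Fin (2 * W + 1) → F) (hpt : Function.Injective pt)
    (hF : Fintype.card F * Fintype.card F ≤ 2 ^ (b * w))
    (blk : Fin n → Fin d × Fin e) (hblk : Function.Injective blk)
    (H : Fin e × Fin e → Fin n) (hH : ∀ y, (Finset.univ.filter (fun x => H x = y)).card ≤ h)
    (N : Fin (2 * W + 1) × Fin t → Fin n)
    (hN : ∀ y, (Finset.univ.filter (fun x => N x = y)).card ≤ g)
    (h1 : n ≤ L) (h2 : h * (d * d) ≤ L) (h3 : h * ((2 * W + 1) * t) ≤ L) (h4 : g * (e * e) ≤ L)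
    (hL : 2 * L ≤ n * r) :
    Computes n b (8 * (w * r)) (fun (x : Fin n → (Fin n → ℕ∞) × (Fin n → ℕ∞)) i v =>
      minPlus W (fun u => (x u).1) (fun u => (x u).2) i v) := by
  classical
  let _ : Inhabited F := ⟨0⟩
  have hcF : 2 * W + 1 ≤ Fintype.card F := by
    simpa using Fintype.card_le_of_injective pt hpt
  have hV1 : Fintype.card (Option (Fin (W + 1)) × Option (Fin (W + 1))) ≤ 2 ^ (b * w) := by
    refine le_trans ?_ hF
    simp only [Fintype.card_prod, Fintype.card_option, Fintype.card_fin]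
    exact Nat.mul_le_mul (by omega) (by omega)
  have hV2 : Fintype.card (F × F) ≤ 2 ^ (b * w) := by simpa using hF
  have hV3 : Fintype.card F ≤ 2 ^ (b * w) := by nlinarith
  have hV4 : Fintype.card (Option (Fin (2 * W + 1))) ≤ 2 ^ (b * w) := by
    simp only [Fintype.card_option, Fintype.card_fin]
    nlinarith
  have hid : ∀ y : Fin n, (Finset.univ.filter (fun x => id x = y)).card ≤ 1 := by
    intro y; simp [Finset.filter_eq']
  let S : Fin n × Fin n → (Fin e × Fin e) × (Fin d × Fin d) := fun p =>
    (((blk p.1).2, (blk p.2).2), ((blk p.1).1, (blk p.2).1))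
  have hS : Function.Injective S := by
    rintro ⟨a, b⟩ ⟨a', b'⟩ hab
    simp only [S, Prod.mk.injEq] at hab
    obtain ⟨⟨q1, q2⟩, q3, q4⟩ := hab
    rw [Prod.mk.injEq]
    exact ⟨hblk (Prod.ext q3 q1), hblk (Prod.ext q4 q2)⟩
  have f1 := card_fiber_le (L := L) id (id : Fin n × Fin n → Fin n × Fin n) Function.injective_id hid
    (by simpa using h1)
  have f2 := card_fiber_le (L := L) H S hS hH (by simpa using h2)
  have f3 := card_fiber_le (L := L) H
    (id : (Fin e × Fin e) × (Fin (2 * W + 1) × Fin t) → _) Function.injective_id hH (by simpa using h3)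
  have f4 := card_fiber_le (L := L) N
    (Prod.swap : (Fin e × Fin e) × (Fin (2 * W + 1) × Fin t) → _) Prod.swap_injective hN
    (by simpa using h4)
  -- Node `H y` gets the entries at position y of all blocks, so it forms locally the y-entries of
  -- all linear combinations, at all points. Node `N (q, μ)` collects the two e × e matrices for
  -- point q and product μ and multiplies them. The results return to the positions, where they are
  -- combined and interpolated, and then to the rows.
  have st1 := Computes.route (I := (Fin n → ℕ∞) × (Fin n → ℕ∞)) hV1 _ _ f1 f2 hL
    (fun p s => (encodeTrunc W (s.1 p.2), encodeTrunc W (s.2 p.2)))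
  have st2 := Computes.route (I := Fin n × Fin n → Option (Fin (W + 1)) × Option (Fin (W + 1)))
    (V := F × F) hV2 _ _ f3 f4 hL (fun p z =>
      (∑ q : Fin n × Fin n, if (blk q.1).2 = p.1.1 ∧ (blk q.2).2 = p.1.2 then
        s.α (blk q.1).1 (blk q.2).1 p.2.2 * evalCode (pt p.2.1) (z q).1 else 0,
       ∑ q : Fin n × Fin n, if (blk q.1).2 = p.1.1 ∧ (blk q.2).2 = p.1.2 then
        s.β (blk q.2).1 (blk q.1).1 p.2.2 * evalCode (pt p.2.1) (z q).2 else 0))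
  have st3 := Computes.route (I := (Fin e × Fin e) × (Fin (2 * W + 1) × Fin t) → F × F)
    (V := F) hV3 _ _ f4 f3 hL (fun p z =>
      ∑ c, (z ((p.1.1, c), p.2)).1 * (z ((c, p.1.2), p.2)).2)
  have st4 := Computes.route (I := (Fin e × Fin e) × (Fin (2 * W + 1) × Fin t) → F)
    hV4 _ _ f2 f1 hL (fun p z => encodeTrunc (2 * W) (leastExponent pt (fun q =>
      ∑ μ, s.lam (blk p.1).1 (blk p.2).1 μ * z (((blk p.1).2, (blk p.2).2), (q, μ)))))
  have st5 := Computes.local_map (n := n) (b := b)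
    (I := Fin n × Fin n → Option (Fin (2 * W + 1))) (fun i z v => decodeTrunc (z (i, v)))
  refine (st5.comp (st4.comp (st3.comp (st2.comp st1)))).congr (by ring) fun x i => ?_
  funext v
  simp only [id, S, Prod.swap, if_true]
  rw [decodeTrunc_encodeTrunc]
  have hz : ∀ q : Fin (2 * W + 1), _ = _ := fun q => s.block_mul blk hblk
    (fun u v => evalCode (pt q) (encodeTrunc W ((x u).1 v)))
    (fun u v => evalCode (pt q) (encodeTrunc W ((x u).2 v))) i v
  have hd := leastExponent_sum hn pt hpt (fun u => encodeTrunc W ((x i).1 u))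
    (fun u => encodeTrunc W ((x u).2 v))
  simp only [decodeTrunc_encodeTrunc] at hd
  rw [← trunc_minPlus, minPlus, ← hd]
  congr 2
  funext q
  rw [← hz q]
  refine Finset.sum_congr rfl fun μ _ => ?_
  congr 1
  refine Finset.sum_congr rfl fun c _ => ?_
  congr 1
  · refine Finset.sum_congr rfl fun p _ => ?_
    by_cases hp : (blk p.1).2 = (blk i).2 ∧ (blk p.2).2 = c
    · rw [if_pos hp, if_pos hp, hp.1, hp.2, if_pos rfl]
    · rw [if_neg hp, if_neg hp]
  · refine Finset.sum_congr rfl fun p _ => ?_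
    by_cases hp : (blk p.1).2 = c ∧ (blk p.2).2 = (blk v).2
    · rw [if_pos hp, if_pos hp, hp.1, hp.2, if_pos rfl]
    · rw [if_neg hp, if_neg hp]

/-! ### Splitting walks and windows of distances -/

theorem trunc_mono {W : ℕ} {a b : ℕ∞} (h : a ≤ b) : trunc W a ≤ trunc W b := by
  unfold trunc
  split_ifs with h1 h2
  · exact h
  · exact le_top
  · exact (h1 (h.trans ‹_›)).elim
  · exact le_rfl

theorem le_trunc (W : ℕ) (a : ℕ∞) : a ≤ trunc W a := by
  unfold trunc
  split_ifs
  · exact le_rfl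
  · exact le_top

theorem trunc_of_le {W : ℕ} {a : ℕ∞} (h : a ≤ W) : trunc W a = a := if_pos h

theorem trunc_trunc (W : ℕ) (a : ℕ∞) : trunc W (trunc W a) = trunc W a := by
  by_cases h : a ≤ W
  · rw [trunc_of_le h, trunc_of_le h]
  · simp [trunc, h]

theorem trunc_eq_trunc {W : ℕ} {a b : ℕ∞} (h : a ≤ b) (h' : a ≤ W → b ≤ a) :
    trunc W b = trunc W a := by
  by_cases ha : a ≤ W
  · rw [le_antisymm (h' ha) h]
  · have hb : ¬ b ≤ W := fun hb => ha (h.trans hb)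
    simp [trunc, ha, hb]

namespace WeightedGraph

variable {n M : ℕ} (G : WeightedGraph n M)

@[simp] theorem walkLength_nil {u : Fin n} : G.walkLength (SimpleGraph.Walk.nil : G.graph.Walk u u) = 0 := by
  simp [walkLength]

@[simp] theorem walkLength_cons {u v w : Fin n} (h : G.graph.Adj u v) (p : G.graph.Walk v w) :
    G.walkLength (SimpleGraph.Walk.cons h p) = G.weight u v + G.walkLength p := by
  simp [walkLength]

theorem walkLength_append {u v w : Fin n} (p : G.graph.Walk u v) (q : G.graph.Walk v w) :
    G.walkLength (p.append q) = G.walkLength p + G.walkLength q := by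
  simp [walkLength, SimpleGraph.Walk.darts_append]

theorem dist_le_walkLength {u v : Fin n} (p : G.graph.Walk u v) : G.dist u v ≤ G.walkLength p :=
  iInf_le _ p

theorem exists_walkLength_eq_dist {u v : Fin n} (h : G.dist u v ≠ ⊤) :
    ∃ p : G.graph.Walk u v, (G.walkLength p : ℕ∞) = G.dist u v := by
  rcases isEmpty_or_nonempty (G.graph.Walk u v) with h' | h'
  · exact (h (by simp [dist])).elim
  · exact ciInf_mem (fun p : G.graph.Walk u v => (G.walkLength p : ℕ∞))

@[simp] theorem dist_self (u : Fin n) : G.dist u u = 0 := by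
  simpa using G.dist_le_walkLength (SimpleGraph.Walk.nil : G.graph.Walk u u)

theorem dist_triangle (u w v : Fin n) : G.dist u v ≤ G.dist u w + G.dist w v := by
  by_cases h1 : G.dist u w = ⊤
  · simp [h1]
  by_cases h2 : G.dist w v = ⊤
  · simp [h2]
  obtain ⟨p, hp⟩ := G.exists_walkLength_eq_dist h1
  obtain ⟨q, hq⟩ := G.exists_walkLength_eq_dist h2
  rw [← hp, ← hq, ← Nat.cast_add, ← walkLength_append]
  exact G.dist_le_walkLength _

/-- Cut at the first vertex where the accumulated weight reaches h; the last edge overshoots by at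
most M. -/
theorem exists_split_walkLength {u v : Fin n} (p : G.graph.Walk u v) :
    ∀ h ≤ G.walkLength p, ∃ (w : Fin n) (q : G.graph.Walk u w) (r : G.graph.Walk w v),
      G.walkLength q + G.walkLength r = G.walkLength p ∧ h ≤ G.walkLength q ∧
      G.walkLength q ≤ h + M ∧ (h = 0 → G.walkLength q = 0) := by
  induction p with
  | nil =>
    intro h hh
    exact ⟨_, .nil, .nil, by simpa using hh⟩
  | @cons u v' w' e p ih =>
    intro h hh
    have hM := G.weight_le u v' e
    rw [walkLength_cons] at hh
    by_cases h0 : h = 0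
    · exact ⟨_, .nil, .cons e p, by simp [h0]⟩
    by_cases h1 : h ≤ G.weight u v'
    · refine ⟨_, .cons e .nil, p, ?_⟩
      simp only [walkLength_cons, walkLength_nil]
      omega
    · obtain ⟨w, q, r, h2, h3, h4, h5⟩ := ih (h - G.weight u v') (by omega)
      refine ⟨w, .cons e q, r, ?_⟩
      simp only [walkLength_cons]
      omega

theorem exists_split_length {u v : Fin n} (p : G.graph.Walk u v) :
    ∀ a b, p.length ≤ a + b → ∃ (w : Fin n) (q : G.graph.Walk u w) (r : G.graph.Walk w v),
      G.walkLength q + G.walkLength r = G.walkLength p ∧ q.length ≤ a ∧ r.length ≤ b := by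
  induction p with
  | nil =>
    intro a b _
    exact ⟨_, .nil, .nil, by simp⟩
  | @cons u v' w' e p ih =>
    intro a b hab
    rw [SimpleGraph.Walk.length_cons] at hab
    cases a with
    | zero => exact ⟨_, .nil, .cons e p, by simpa using hab⟩
    | succ a =>
      obtain ⟨w, q, r, h1, h2, h3⟩ := ih a b (by omega)
      refine ⟨w, .cons e q, r, ?_⟩
      simp only [walkLength_cons, SimpleGraph.Walk.length_cons]
      omega

theorem walkLength_bypass_le {u v : Fin n} (p : G.graph.Walk u v) :
    G.walkLength p.bypass ≤ G.walkLength p := by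
  induction p with
  | nil => simp [SimpleGraph.Walk.bypass]
  | @cons u v' w' e p ih =>
    rw [SimpleGraph.Walk.bypass]
    split_ifs with hs
    · have h1 := congrArg G.walkLength (p.bypass.take_spec hs)
      rw [walkLength_append] at h1
      rw [walkLength_cons]
      omega
    · rw [walkLength_cons, walkLength_cons]
      omega

theorem walkLength_le_length_mul {u v : Fin n} (p : G.graph.Walk u v) :
    G.walkLength p ≤ p.length * M := by
  induction p with
  | nil => simp
  | @cons u v' w' e p ih =>
    have hM := G.weight_le u v' e
    rw [walkLength_cons, SimpleGraph.Walk.length_cons]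
    linarith

theorem exists_short_walk {u v : Fin n} (h : G.dist u v ≠ ⊤) :
    ∃ p : G.graph.Walk u v, (G.walkLength p : ℕ∞) = G.dist u v ∧ p.length ≤ n := by
  obtain ⟨p, hp⟩ := G.exists_walkLength_eq_dist h
  refine ⟨p.bypass, le_antisymm ?_ (G.dist_le_walkLength _), ?_⟩
  · rw [← hp]
    exact_mod_cast G.walkLength_bypass_le p
  · have := p.bypass_isPath.length_lt
    rw [Fintype.card_fin] at this
    exact this.le

/-- By the triangle inequality both parts of a split shortest walk are themselves shortest. -/
theorem exists_middle {u v : Fin n} {x : ℕ} (hx : G.dist u v = x) (h : ℕ) (hh : h ≤ x) :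
    ∃ (w : Fin n) (y z : ℕ), G.dist u w = y ∧ G.dist w v = z ∧ y + z = x ∧ h ≤ y ∧ y ≤ h + M ∧
      (h = 0 → y = 0) := by
  obtain ⟨p, hp⟩ := G.exists_walkLength_eq_dist (u := u) (v := v) (by simp [hx])
  rw [hx] at hp
  have hp' : G.walkLength p = x := by exact_mod_cast hp
  obtain ⟨w, q, r, h1, h2, h3, h4⟩ := G.exists_split_walkLength p h (by omega)
  have hq := G.dist_le_walkLength q
  have hr := G.dist_le_walkLength r
  have ht := G.dist_triangle u w v
  obtain ⟨y, hy⟩ := ENat.ne_top_iff_exists.1 (ne_top_of_le_ne_top (ENat.natCast_ne_top _) hq)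
  obtain ⟨z, hz⟩ := ENat.ne_top_iff_exists.1 (ne_top_of_le_ne_top (ENat.natCast_ne_top _) hr)
  rw [← hy, ← hz, hx] at ht
  rw [← hy] at hq
  rw [← hz] at hr
  have hq' : y ≤ G.walkLength q := by exact_mod_cast hq
  have hr' : z ≤ G.walkLength r := by exact_mod_cast hr
  have ht' : x ≤ y + z := by exact_mod_cast ht
  refine ⟨w, y, z, hy.symm, hz.symm, ?_⟩
  omega

/-- The distances within `2 * M` of `T`, shifted to the interval from `0` to `4 * M`; smaller
distances become `0` and larger ones `⊤`. -/
noncomputable def window (T : ℕ) (u v : Fin n) : ℕ∞ :=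
  trunc (4 * M) (G.dist u v + (2 * M : ℕ) - T)

theorem window_mono (T : ℕ) {u v u' v' : Fin n} (h : G.dist u v ≤ G.dist u' v') :
    G.window T u v ≤ G.window T u' v' :=
  trunc_mono (tsub_le_tsub_right (add_le_add h le_rfl) _)

theorem lt_window_iff (T : ℕ) (u v : Fin n) :
    ((2 * M : ℕ) : ℕ∞) < G.window T u v ↔ (T : ℕ∞) < G.dist u v := by
  unfold window
  cases hd : G.dist u v with
  | top =>
    have h1 : ¬ ((⊤ : ℕ∞) ≤ ((4 * M : ℕ) : ℕ∞)) := by rw [top_le_iff]; exact ENat.natCast_ne_top _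
    rw [top_add, ENat.top_sub_natCast, trunc, if_neg h1]
    exact iff_of_true (ENat.natCast_lt_top _) (ENat.natCast_lt_top _)
  | coe x =>
    unfold trunc
    norm_cast
    split_ifs with h
    · norm_cast; omega
    · simp only [ENat.natCast_lt_top, true_iff]
      omega

/-- The triangle inequality gives one direction, since clipping a window, at 0 or to ⊤, only raises
values. For the other, cut a shortest walk where each part carries about half of the deviation from
S + T; an overshoot of M and the rounding still fit in the windows. Both factors are shifted by 2M,
hence the subtraction of one shift. -/
theorem window_add_eq (hM : 1 ≤ M) (S T : ℕ) (u v : Fin n) :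
    trunc (4 * M) (minPlus (4 * M) (G.window S) (G.window T) u v - (2 * M : ℕ)) =
      G.window (S + T) u v := by
  refine trunc_eq_trunc ?_ ?_
  · by_cases h0 : G.dist u v + (2 * M : ℕ) - (S + T : ℕ) = 0
    · rw [h0]; exact zero_le
    apply ENat.le_sub_of_add_le_right (ENat.natCast_ne_top _)
    refine le_iInf fun w => ?_
    simp only [window, trunc_trunc]
    refine le_trans ?_ (add_le_add (le_trunc _ _) (le_trunc _ _))
    have ht := G.dist_triangle u w v
    revert ht h0
    cases hx : G.dist u w with
    | top => simp
    | coe y =>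
      cases hz : G.dist w v with
      | top => simp
      | coe z =>
        cases G.dist u v with
        | top => 
          intro _ h
          rw [← Nat.cast_add, top_le_iff] at h
          exact (ENat.natCast_ne_top _ h).elim
        | coe x =>
          intro h0 h
          norm_cast at h0 h ⊢
          omega
  · cases hx : G.dist u v with
    | top =>
      intro h
      rw [top_add, ENat.top_sub_natCast, top_le_iff] at h
      exact (ENat.natCast_ne_top _ h).elim
    | coe x =>
      intro h
      norm_cast at h
      obtain ⟨w, y, z, hy, hz, h1, h2, h3, h4⟩ :=
        -- The ideal cut is S + (x - S - T) / 2, clamped to the interval from 0 to x. At 0 no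
        -- overshoot is allowed, which the last clause of `exists_middle` ensures.
        G.exists_middle hx (min ((x + S - T) / 2) x) (min_le_right _ _)
      refine (tsub_le_tsub_right (iInf_le _ w) _).trans ?_
      simp only [window, trunc_trunc, hy, hz]
      norm_cast
      rw [trunc_of_le (by norm_cast; omega), trunc_of_le (by norm_cast; omega)]
      norm_cast
      omega

end WeightedGraph
-- Short distances by repeated squaring
/-- Repeated min-plus squaring of a matrix that is stored by rows. -/
noncomputable def squareStep {n : ℕ} (W : ℕ) (x : Fin n → Fin n → ℕ∞) : Fin n → Fin n → ℕ∞ :=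
  minPlus W x x

namespace WeightedGraph

variable {n M : ℕ} (G : WeightedGraph n M)

/-- The adjacency matrix with zeros on the diagonal. -/
noncomputable def reflAdjMatrix (u v : Fin n) : ℕ∞ := if v = u then 0 else G.adjMatrix u v

theorem dist_le_reflAdjMatrix (u v : Fin n) : G.dist u v ≤ G.reflAdjMatrix u v := by
  unfold reflAdjMatrix adjMatrix
  split_ifs with h1 h2
  · rw [h1]; simp
  · simpa using G.dist_le_walkLength (.cons h2 .nil)
  · exact le_top

theorem reflAdjMatrix_le {u v : Fin n} (p : G.graph.Walk u v) (hp : p.length ≤ 1) :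
    G.reflAdjMatrix u v ≤ G.walkLength p := by
  cases p with
  | nil => simp [reflAdjMatrix]
  | cons e q =>
    cases q with
    | nil => simp [reflAdjMatrix, adjMatrix, e, e.ne']
    | cons e' q => simp at hp

theorem dist_le_iterate_squareStep (W k : ℕ) (u v : Fin n) :
    G.dist u v ≤ (squareStep W)^[k] G.reflAdjMatrix u v := by
  induction k generalizing u v with
  | zero => exact G.dist_le_reflAdjMatrix u v
  | succ k ih =>
    rw [Function.iterate_succ_apply']
    refine le_iInf fun w => (G.dist_triangle u w v).trans ?_
    exact add_le_add ((ih u w).trans (le_trunc _ _)) ((ih w v).trans (le_trunc _ _))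

/-- Halve the walk by number of edges. Weights are nonnegative, so both halves still weigh at most W
and truncation does not affect them. -/
theorem iterate_squareStep_le (W k : ℕ) {u v : Fin n} (p : G.graph.Walk u v)
    (hp : p.length ≤ 2 ^ k) (hW : G.walkLength p ≤ W) :
    (squareStep W)^[k] G.reflAdjMatrix u v ≤ G.walkLength p := by
  induction k generalizing u v with
  | zero => exact G.reflAdjMatrix_le p (by simpa using hp)
  | succ k ih =>
    rw [Function.iterate_succ_apply']
    obtain ⟨w, q, r, h1, h2, h3⟩ := G.exists_split_length p (2 ^ k) (2 ^ k) (by rw [pow_succ] at hp; omega)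
    have hq := ih q h2 (by omega)
    have hr := ih r h3 (by omega)
    refine (iInf_le _ w).trans ?_
    rw [trunc_of_le (hq.trans (by norm_cast; omega)), trunc_of_le (hr.trans (by norm_cast; omega)),
      ← h1]
    push_cast
    exact add_le_add hq hr

/-- For T ≤ 2M the window only shows distances up to 4M, and these are exact after k squarings
because shortest walks with at most n edges exist. -/
theorem window_eq_of_iterate {k T : ℕ} (hk : n ≤ 2 ^ k) (hT : T ≤ 2 * M) (u v : Fin n) :
    trunc (4 * M) ((squareStep (4 * M))^[k] G.reflAdjMatrix u v + (2 * M : ℕ) - T) =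
      G.window T u v := by
  refine trunc_eq_trunc (tsub_le_tsub_right (add_le_add
    (G.dist_le_iterate_squareStep _ _ _ _) le_rfl) _) fun h => ?_
  refine tsub_le_tsub_right (add_le_add ?_ le_rfl) _
  by_cases hd : G.dist u v = ⊤
  · rw [hd]; exact le_top
  obtain ⟨p, hp, hp'⟩ := G.exists_short_walk hd
  rw [← hp] at h ⊢
  norm_cast at h
  exact G.iterate_squareStep_le _ _ p (hp'.trans hk) (by omega)

theorem exists_dist_eq_diameter (hn : 1 ≤ n) : ∃ u v, G.dist u v = G.diameter := by
  have : Nonempty (Fin n) := ⟨⟨0, hn⟩⟩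
  obtain ⟨u, hu⟩ := exists_eq_ciSup_of_finite (f := fun u => ⨆ v, G.dist u v)
  obtain ⟨v, hv⟩ := exists_eq_ciSup_of_finite (f := fun v => G.dist u v)
  exact ⟨u, v, hv.trans hu⟩

theorem dist_le_diameter (u v : Fin n) : G.dist u v ≤ G.diameter :=
  le_iSup₂_of_le u v le_rfl

theorem diameter_le (hn : 1 ≤ n) (h : G.diameter ≠ ⊤) : G.diameter ≤ (n * M : ℕ) := by
  obtain ⟨u, v, huv⟩ := G.exists_dist_eq_diameter hn
  rw [← huv] at h ⊢
  obtain ⟨p, hp, hp'⟩ := G.exists_short_walk h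
  rw [← hp]
  exact_mod_cast (G.walkLength_le_length_mul p).trans (Nat.mul_le_mul_right _ hp')

/-- Row `i` of the windows around `M * 2 ^ j` for `j < m`, the last one first. -/
noncomputable def ladder : ℕ → Fin n → List (Fin n → ℕ∞)
  | 0, _ => []
  | m + 1, i => G.window (2 ^ m * M) i :: ladder m i

@[simp] theorem length_ladder (m : ℕ) (i : Fin n) : (G.ladder m i).length = m := by
  induction m with
  | zero => rfl
  | succ m ih => simp [ladder, ih]

end WeightedGraph

/-! ### Binary search for the diameter -/

/-- The local state in the search: a row of the current window, its centre, and a stack of rows. -/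
abbrev SearchState (n : ℕ) : Type := (Fin n → ℕ∞) × ℕ × List (Fin n → ℕ∞)

/-- The row on top of the stack. -/
def SearchState.top {n : ℕ} (s : SearchState n) : Fin n → ℕ∞ := s.2.2.headD (fun _ => 0)

/-- Push the window around twice the centre of the top one. -/
noncomputable def ladderStep {n : ℕ} (M : ℕ) (x : Fin n → SearchState n) (i : Fin n) :
    SearchState n :=
  ((x i).1, (x i).2.1, (fun v => trunc (4 * M) (minPlus (4 * M) (fun u => (x u).top)
    (fun u => (x u).top) i v - (2 * M : ℕ))) :: (x i).2.2)

/-- The window whose centre is the sum of those of the current and of the top one. -/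
noncomputable def trialWindow {n : ℕ} (M : ℕ) (x : Fin n → SearchState n) (i v : Fin n) : ℕ∞ :=
  trunc (4 * M) (minPlus (4 * M) (fun u => (x u).1) (fun u => (x u).top) i v - (2 * M : ℕ))

open Classical in
/-- Move the centre if some distance is beyond the trial centre. -/
noncomputable def searchStep {n : ℕ} (M : ℕ) (x : Fin n → SearchState n) (i : Fin n) :
    SearchState n :=
  if ∃ j v, ((2 * M : ℕ) : ℕ∞) < trialWindow M x j v then
    -- The height of the stack determines the centre of its top window.
    (trialWindow M x i, (x i).2.1 + 2 ^ ((x i).2.2.length - 1) * M, (x i).2.2.tail)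
  else ((x i).1, (x i).2.1, (x i).2.2.tail)

/-- The state before the search. -/
noncomputable def initState {n : ℕ} (M : ℕ) (x : Fin n → ℕ∞) : SearchState n :=
  (fun v => trunc (4 * M) (x v + (2 * M : ℕ) - (0 : ℕ)), 0,
    [fun v => trunc (4 * M) (x v + (2 * M : ℕ) - (M : ℕ))])

/-- The value that is read off at the end of the search. -/
noncomputable def readDiameter {n : ℕ} (M : ℕ) (x : Fin n → SearchState n) (i : Fin n) : ℕ∞ :=
  (⨆ j, trunc (4 * M) (⨆ v, (x j).1 v)) + (x i).2.1 - (2 * M : ℕ)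

namespace WeightedGraph

variable {n M : ℕ} (G : WeightedGraph n M)

theorem iterate_ladderStep (hM : 1 ≤ M) (k : ℕ) (i : Fin n) :
    (ladderStep M)^[k] (fun i => (G.window 0 i, 0, G.ladder 1 i)) i =
      (G.window 0 i, 0, G.ladder (k + 1) i) := by
  induction k generalizing i with
  | zero => rfl
  | succ k ih =>
    have ih' := funext ih
    rw [Function.iterate_succ_apply', ih', ladderStep]
    simp only [ladder, SearchState.top, List.headD_cons]
    congr 3
    funext v
    have := G.window_add_eq hM (2 ^ k * M) (2 ^ k * M) i v
    rw [pow_succ, mul_two, add_mul]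
    exact this

/-- The invariant of the search. -/
def SearchInvariant (m : ℕ) (x : Fin n → SearchState n) : Prop :=
  ∃ S : ℕ, (S : ℕ∞) ≤ G.diameter ∧
    (G.diameter ≠ ⊤ → G.diameter ≤ (S + 2 ^ m * M : ℕ)) ∧
    ∀ i, x i = (G.window S i, S, G.ladder m i)

/-- By `lt_window_iff`, an entry above 2M in the trial window means a distance beyond the trial
centre. Either outcome halves the interval that contains a finite diameter; an infinite one always
moves the centre. -/
theorem SearchInvariant.step {m : ℕ} {x : Fin n → SearchState n} (hn : 1 ≤ n) (hM : 1 ≤ M)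
    (h : G.SearchInvariant (m + 1) x) : G.SearchInvariant m (searchStep M x) := by
  obtain ⟨S, h1, h2, h3⟩ := h
  have ht : ∀ i v, trialWindow M x i v = G.window (S + 2 ^ m * M) i v := by
    intro i v
    simp only [trialWindow, h3, SearchState.top, ladder, List.headD_cons]
    exact G.window_add_eq hM _ _ i v
  have hc : (∃ j v, ((2 * M : ℕ) : ℕ∞) < trialWindow M x j v) ↔
      ((S + 2 ^ m * M : ℕ) : ℕ∞) < G.diameter := by
    simp only [ht, lt_window_iff]
    constructor
    · rintro ⟨j, v, h⟩
      exact h.trans_le (G.dist_le_diameter j v)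
    · intro h
      obtain ⟨u, v, huv⟩ := G.exists_dist_eq_diameter hn
      exact ⟨u, v, huv ▸ h⟩
  by_cases hD : ((S + 2 ^ m * M : ℕ) : ℕ∞) < G.diameter
  · refine ⟨S + 2 ^ m * M, hD.le, fun h => (h2 h).trans ?_, fun i => ?_⟩
    · norm_cast
      rw [pow_succ]
      linarith
    · rw [searchStep, if_pos (hc.2 hD), h3 i]
      simp only [ladder, List.length_cons, length_ladder, Nat.add_sub_cancel, List.tail_cons]
      congr 1
      exact funext (ht i)
  · refine ⟨S, h1, fun _ => not_lt.1 hD, fun i => ?_⟩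
    rw [searchStep, if_neg (fun h => hD (hc.1 h)), h3 i]
    rfl

theorem SearchInvariant.iterate {m : ℕ} {x : Fin n → SearchState n} (hn : 1 ≤ n) (hM : 1 ≤ M)
    (h : G.SearchInvariant m x) : G.SearchInvariant 0 ((searchStep M)^[m] x) := by
  induction m generalizing x with
  | zero => exact h
  | succ m ih => exact ih (SearchInvariant.step G hn hM h)

/-- A finite diameter is now between S and S + M, inside the window, so the largest entry of the
window determines it; if it is infinite, that entry is ⊤. -/
theorem SearchInvariant.readDiameter_eq {x : Fin n → SearchState n} (hn : 1 ≤ n)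
    (h : G.SearchInvariant 0 x) (i : Fin n) : readDiameter M x i = G.diameter := by
  obtain ⟨S, h1, h2, h3⟩ := h
  obtain ⟨u, v, huv⟩ := G.exists_dist_eq_diameter hn
  have hsup : ⨆ j, trunc (4 * M) (⨆ v, (x j).1 v) = G.window S u v := by
    simp only [h3]
    apply le_antisymm
    · refine iSup_le fun j => ?_
      refine (trunc_mono (iSup_le fun v' => G.window_mono S (u := j) (v := v') (u' := u) (v' := v)
        (huv ▸ G.dist_le_diameter j v'))).trans ?_
      rw [window, trunc_trunc]
    · exact (le_iSup (fun v => G.window S u v) v).trans ((le_trunc _ _).trans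
        (le_iSup (fun j => trunc (4 * M) (⨆ v, G.window S j v)) u))
  rw [readDiameter, hsup, h3 i, window, huv]
  dsimp only
  cases hD : G.diameter with
  | top =>
    have h1 : ¬ ((⊤ : ℕ∞) ≤ ((4 * M : ℕ) : ℕ∞)) := by rw [top_le_iff]; exact ENat.natCast_ne_top _
    rw [top_add, ENat.top_sub_natCast, trunc, if_neg h1, top_add, ENat.top_sub_natCast]
  | coe D =>
    rw [hD] at h1 h2
    have h2 := h2 (ENat.natCast_ne_top _)
    norm_cast at h1 h2
    norm_cast
    rw [trunc_of_le (by norm_cast; omega)]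
    norm_cast
    omega

/-- The whole sequence of steps yields the diameter. -/
theorem readDiameter_search (hn : 1 ≤ n) (hM : 1 ≤ M) {k : ℕ} (hk : n ≤ 2 ^ k) (i : Fin n) :
    readDiameter M ((searchStep M)^[k + 1] ((ladderStep M)^[k] (fun i => initState M
      ((squareStep (4 * M))^[k] G.reflAdjMatrix i)))) i = G.diameter := by
  refine SearchInvariant.readDiameter_eq G hn (SearchInvariant.iterate G hn hM ?_) i
  have : (fun i => initState M ((squareStep (4 * M))^[k] G.reflAdjMatrix i)) =
      (fun i => (G.window 0 i, 0, G.ladder 1 i)) := by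
    funext i
    simp only [initState, ladder, pow_zero, one_mul]
    congr 1
    · funext v; exact G.window_eq_of_iterate hk (by omega) i v
    · congr 2; funext v; exact G.window_eq_of_iterate hk (by omega) i v
  rw [this]
  refine ⟨0, by simp, fun h => (G.diameter_le hn h).trans ?_, G.iterate_ladderStep hM k⟩
  norm_cast
  rw [zero_add]
  exact Nat.mul_le_mul_right _ (hk.trans (Nat.pow_le_pow_right (by omega) (by omega)))

end WeightedGraph

/-! ### Choice of parameters and the round count -/

/-- The diameter is found with a logarithmic number of min-plus products. -/
theorem exists_protocol_of_computes_minPlus {n b R w k M : ℕ} (hn : 1 ≤ n) (hM : 1 ≤ M)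
    (hk : n ≤ 2 ^ k) (hw : 4 * M + 2 ≤ 2 ^ (b * w))
    (h : Computes n b R (fun (x : Fin n → (Fin n → ℕ∞) × (Fin n → ℕ∞)) i v =>
      minPlus (4 * M) (fun u => (x u).1) (fun u => (x u).2) i v)) :
    ∃ P : Protocol n b (Fin n → ℕ∞) ℕ∞, ComputesDiameter M P ∧
      P.rounds = k * R + k * R + (k + 1) * (R + w) + w := by
  classical
  have c0 : Computes n b 0 (fun (x : Fin n → Fin n → ℕ∞) i v => if v = i then 0 else x i v) :=
    Computes.local_map (fun i (s : Fin n → ℕ∞) v => if v = i then 0 else s v)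
  have c1 : Computes n b R (squareStep (n := n) (4 * M)) :=
    h.lift (fun _ s => (s, s)) (fun _ _ o => o)
  have c2 : Computes n b 0 (fun (x : Fin n → Fin n → ℕ∞) i => initState M (x i)) :=
    Computes.local_map (fun _ s => initState M s)
  have c3 : Computes n b R (ladderStep (n := n) M) :=
    h.lift (fun _ (s : SearchState n) => (s.top, s.top)) (fun _ s o =>
      (s.1, s.2.1, (fun v => trunc (4 * M) (o v - (2 * M : ℕ))) :: s.2.2))
  have c4 : Computes n b R (fun (x : Fin n → SearchState n) i => (x i, trialWindow M x i)) :=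
    h.lift (fun _ (s : SearchState n) => (s.1, s.top))
      (fun _ s o => (s, fun v => trunc (4 * M) (o v - (2 * M : ℕ))))
  have c5 := Computes.exchange (n := n) (b := b) (w := w) (V := Bool)
    (by rw [Fintype.card_bool]; omega)
    (fun _ (s : SearchState n × (Fin n → ℕ∞)) _ => decide (∃ v, ((2 * M : ℕ) : ℕ∞) < s.2 v))
  have c6 := c5.lift (fun _ s => s) (fun _ s o => if ∃ j, o j = true then
    (s.2, s.1.2.1 + 2 ^ (s.1.2.2.length - 1) * M, s.1.2.2.tail)
    else (s.1.1, s.1.2.1, s.1.2.2.tail))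
  have c7 : Computes n b (R + w) (searchStep (n := n) M) :=
    (c6.comp c4).congr rfl (fun x i => by simp only [decide_eq_true_eq, searchStep])
  have c8 := Computes.exchange (n := n) (b := b) (w := w) (V := Option (Fin (4 * M + 1)))
    (by rw [Fintype.card_option, Fintype.card_fin]; omega)
    (fun _ (s : SearchState n) _ => encodeTrunc (4 * M) (⨆ v, s.1 v))
  have c9 : Computes n b w (readDiameter (n := n) M) :=
    (c8.lift (fun _ s => s) (fun _ s o => (⨆ j, decodeTrunc (o j)) + s.2.1 - (2 * M : ℕ))).congr rfl
      (fun x i => by simp only [decodeTrunc_encodeTrunc, readDiameter])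
  obtain ⟨P, hP, hP'⟩ := c9.comp ((c7.iterate (k + 1)).comp ((c3.iterate k).comp
    (c2.comp ((c1.iterate k).comp c0))))
  refine ⟨P, fun G i => ?_, by rw [hP]; ring⟩
  rw [hP']
  exact G.readDiameter_search hn hM hk i

theorem exists_balanced (X : Type*) [Fintype X] {n : ℕ} (hn : 0 < n) :
    ∃ H : X → Fin n, ∀ y, (Finset.univ.filter (fun x => H x = y)).card ≤ Fintype.card X / n + 1 := by
  let E := Fintype.equivFin X
  refine ⟨fun x => ⟨(E x : ℕ) % n, Nat.mod_lt _ hn⟩, fun y => ?_⟩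
  rw [← Finset.card_range (Fintype.card X / n + 1)]
  refine Finset.card_le_card_of_injOn (fun x => (E x : ℕ) / n) ?_ ?_
  · intro x _
    simp only [Finset.coe_range, Set.mem_Iio]
    exact Nat.lt_succ_of_le (Nat.div_le_div_right (E x).2.le)
  · intro x hx x' hx' hxx
    simp only [Finset.coe_filter, Finset.mem_univ, true_and, Set.mem_ofPred_eq] at hx hx'
    have h1 : (E x : ℕ) % n = (E x' : ℕ) % n := congrArg Fin.val (hx.trans hx'.symm)
    apply E.injective
    apply Fin.ext
    rw [← Nat.div_add_mod (E x : ℕ) n, ← Nat.div_add_mod (E x' : ℕ) n, h1]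
    simp only at hxx
    rw [hxx]

/-- The min-plus product from one scheme of fixed size, in terms of the block dimension `d`. -/
theorem exists_computes_minPlus {n b w M d t p : ℕ} [Fact p.Prime] (s : Scheme (ZMod p) (Fin d) (Fin t))
    (hM : 1 ≤ M) (hMn : M ≤ n) (hd : 1 ≤ d) (ht : t * M ≤ n) (hp : 9 * n < p)
    (hpw : p * p ≤ 2 ^ (b * w)) :
    ∃ r : ℕ, 1 ≤ r ∧ r * d ^ 2 ≤ 148 * n ∧
      Computes n b (8 * (w * r)) (fun (x : Fin n → (Fin n → ℕ∞) × (Fin n → ℕ∞)) i v =>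
        minPlus (4 * M) (fun u => (x u).1) (fun u => (x u).2) i v) := by
  have hn : 0 < n := by omega
  have hdt : d ^ 2 ≤ t := s.sq_le
  have htn : t ≤ n := le_trans (Nat.le_mul_of_pos_right t hM) ht
  have hdn : d ≤ n := by nlinarith
  have round_up : ∀ a c : ℕ, 0 < c → ∃ q, 1 ≤ q ∧ a ≤ c * q ∧ c * q ≤ a + c := by
    intro a c hc
    refine ⟨a / c + 1, Nat.le_add_left _ _, ?_, ?_⟩
    · rw [mul_add, mul_one]
      have := Nat.div_add_mod a c
      have := Nat.mod_lt a hc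
      omega
    · rw [mul_add, mul_one]
      have := Nat.mul_div_le a c
      omega
  obtain ⟨e, -, hde, hde'⟩ := round_up n d hd
  replace hde' : d * e ≤ 2 * n := by omega
  have hne : n ≤ e * e := by
    have h1 : n * n ≤ (d * e) * (d * e) := Nat.mul_le_mul hde hde
    have h2 : (d * e) * (d * e) = d ^ 2 * (e * e) := by ring
    have h3 : d ^ 2 * (e * e) ≤ n * (e * e) := Nat.mul_le_mul_right _ (hdt.trans htn)
    exact Nat.le_of_mul_le_mul_left (h1.trans (h2.le.trans h3)) hn
  have hkt : (2 * (4 * M) + 1) * t ≤ 9 * n := by nlinarith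
  obtain ⟨blk⟩ := Function.Embedding.nonempty_of_card_le
    (show Fintype.card (Fin n) ≤ Fintype.card (Fin d × Fin e) by simpa using hde)
  obtain ⟨H, hH⟩ := exists_balanced (Fin e × Fin e) hn
  obtain ⟨N, hN⟩ := exists_balanced (Fin (2 * (4 * M) + 1) × Fin t) hn
  simp only [Fintype.card_prod, Fintype.card_fin] at hH hN
  set h := e * e / n + 1 with hh
  set g := (2 * (4 * M) + 1) * t / n + 1 with hg
  have hhn : h * n ≤ 2 * (e * e) := by
    rw [hh, add_mul, one_mul]
    have := Nat.div_mul_le_self (e * e) n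
    omega
  have hg' : g ≤ 10 := by
    have : (2 * (4 * M) + 1) * t / n ≤ 9 * n / n := Nat.div_le_div_right hkt
    rw [Nat.mul_div_cancel _ hn] at this
    omega
  -- The load bound is L = 18e², from h(8M + 1)t ≤ h · 9n and hn ≤ 2e²; routing needs 2L ≤ nr.
  obtain ⟨r, hr, hrn, hrn'⟩ := round_up (36 * (e * e)) n hn
  replace hrn' : n * r ≤ 37 * (e * e) := by omega
  refine ⟨r, hr, ?_, ?_⟩
  · have h1 : n * (r * d ^ 2) ≤ n * (148 * n) := by
      calc n * (r * d ^ 2) = (n * r) * d ^ 2 := by ring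
        _ ≤ 37 * (e * e) * d ^ 2 := Nat.mul_le_mul_right _ hrn'
        _ = 37 * ((d * e) * (d * e)) := by ring
        _ ≤ 37 * ((2 * n) * (2 * n)) := Nat.mul_le_mul_left _ (Nat.mul_le_mul hde' hde')
        _ = n * (148 * n) := by ring
    exact Nat.le_of_mul_le_mul_left h1 hn
  · refine computes_minPlus (L := 18 * (e * e)) (h := h) (g := g) s (by omega) ?_
      (fun q => ((q : ℕ) : ZMod p)) ?_ (by simpa using hpw) blk blk.injective H hH N hN (by omega)
      ?_ ?_ ?_ (by omega)
    · intro m hm0 hmn hm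
      rw [ZMod.natCast_eq_zero_iff] at hm
      have := Nat.le_of_dvd hm0 hm
      omega
    · intro q q' hqq
      have := (ZMod.natCast_eq_natCast_iff' _ _ _).1 hqq
      have h1 := q.2
      have h2 := q'.2
      rw [Nat.mod_eq_of_lt (by omega), Nat.mod_eq_of_lt (by omega)] at this
      exact Fin.ext this
    · have : h * (d * d) ≤ h * n := Nat.mul_le_mul_left _ (by nlinarith)
      omega
    · have : h * ((2 * (4 * M) + 1) * t) ≤ h * (9 * n) := Nat.mul_le_mul_left _ hkt
      nlinarith
    · have : g * (e * e) ≤ 10 * (e * e) := Nat.mul_le_mul_right _ hg'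
      omega

theorem clog_le_log {n : ℕ} (hn : 2 ≤ n) : (Nat.clog 2 n : ℝ) ≤ 4 * Real.log n := by
  have h1 := Nat.pow_pred_clog_lt_self (b := 2) (x := n) (by norm_num) (by omega)
  have hc : 1 ≤ Nat.clog 2 n := Nat.clog_pos (by norm_num) hn
  have h2 : ((2 ^ (Nat.clog 2 n - 1) : ℕ) : ℝ) ≤ n := by exact_mod_cast h1.le
  have h3 := Real.log_le_log (by positivity) h2
  push_cast at h3
  rw [Real.log_pow, Nat.cast_sub hc] at h3
  have h4 : Real.log 2 ≤ Real.log n := Real.log_le_log (by norm_num) (by exact_mod_cast hn)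
  have h5 := Real.log_two_gt_d9
  push_cast at h3
  nlinarith [Real.log_nonneg (show (1 : ℝ) ≤ n by exact_mod_cast (by omega : 1 ≤ n)),
    (Nat.one_le_cast (α := ℝ)).2 hc]

/-- The diameter of a graph with at most one vertex. -/
theorem exists_protocol_one (b M : ℕ) :
    ∃ P : Protocol 1 b (Fin 1 → ℕ∞) ℕ∞, ComputesDiameter M P ∧ P.rounds = 0 := by
  refine ⟨⟨0, fun _ _ _ _ _ => false, fun _ _ _ => 0⟩, fun G i => ?_, rfl⟩
  obtain ⟨u, v, huv⟩ := G.exists_dist_eq_diameter le_rfl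
  rw [← huv, Subsingleton.elim u v, G.dist_self]
  rfl

/-- The block dimension is chosen as a power of the dimension of a fixed scheme. -/
theorem exists_block_dimension {m t : ℕ} {σ : ℝ} (hm : 2 ≤ m) (hσ : 0 < σ)
    (ht : (t : ℝ) ≤ (m : ℝ) ^ σ) {n M : ℕ} (hM : 1 ≤ M) (hMn : M ≤ n) :
    ∃ j : ℕ, t ^ j * M ≤ n ∧
      (n : ℝ) ≤ (m : ℝ) ^ 2 * ((m ^ j : ℕ) : ℝ) ^ 2 * ((M : ℝ) ^ (2 / σ) * (n : ℝ) ^ (1 - 2 / σ)) := by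
  have hm1 : (1 : ℝ) < m := by exact_mod_cast (by omega : 1 < m)
  have hm0 : (0 : ℝ) < m := by linarith
  have hM0 : (0 : ℝ) < M := by exact_mod_cast hM
  have hn0 : (0 : ℝ) < n := by exact_mod_cast (by omega : 0 < n)
  have hMn' : (M : ℝ) ≤ n := by exact_mod_cast hMn
  -- The largest j with m^(σj) ≤ n/M: the rank t^j stays within n/M, and maximality loses only the
  -- factor m².
  obtain ⟨j, h1, h2⟩ := exists_nat_pow_near (x := (n : ℝ) / M) (y := (m : ℝ) ^ σ)
    ((one_le_div hM0).2 hMn') (Real.one_lt_rpow hm1 hσ)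
  refine ⟨j, ?_, ?_⟩
  · have h3 : ((t : ℝ)) ^ j ≤ n / M := (pow_le_pow_left₀ (Nat.cast_nonneg _) ht j).trans h1
    rw [le_div_iff₀ hM0] at h3
    exact_mod_cast h3
  · have h3 : ((n : ℝ) / M) ^ (2 / σ) ≤ (m : ℝ) ^ 2 * ((m ^ j : ℕ) : ℝ) ^ 2 := by
      calc ((n : ℝ) / M) ^ (2 / σ) ≤ (((m : ℝ) ^ σ) ^ (j + 1)) ^ (2 / σ) :=
            Real.rpow_le_rpow (by positivity) h2.le (by positivity)
        _ = (m : ℝ) ^ ((2 * (j + 1) : ℕ) : ℝ) := by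
          rw [← Real.rpow_natCast, ← Real.rpow_mul hm0.le, ← Real.rpow_mul hm0.le]
          congr 1
          push_cast
          field_simp
        _ = _ := by
          rw [Real.rpow_natCast]
          push_cast
          ring
    have h4 : (n : ℝ) = ((n : ℝ) / M) ^ (2 / σ) * ((M : ℝ) ^ (2 / σ) * (n : ℝ) ^ (1 - 2 / σ)) := by
      rw [Real.div_rpow hn0.le hM0.le, ← mul_assoc,
        div_mul_cancel₀ _ (Real.rpow_pos_of_pos hM0 _).ne', ← Real.rpow_add hn0]
      simp
    calc (n : ℝ) = _ := h4
      _ ≤ _ := mul_le_mul_of_nonneg_right h3 (by positivity)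

end CongestedClique

theorem mainTheorem11 (K : Type*) [Field K] [CharZero K] :
    ∃ c : ℕ, ∀ ε : ℝ, 0 < ε → ∃ C : ℝ, ∀ n M : ℕ, 1 ≤ M → M ≤ n →
      ∃ P : CongestedClique.Protocol n (Nat.clog 2 n) (Fin n → ℕ∞) ℕ∞,
        CongestedClique.ComputesDiameter M P ∧
        (P.rounds : ℝ) ≤
          C * ((M : ℝ) ^ (2 / (CongestedClique.matMulExponent K + ε)) *
            (n : ℝ) ^ (1 - 2 / (CongestedClique.matMulExponent K + ε))) * Real.log n ^ c := by
  refine ⟨1, fun ε hε => ?_⟩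
  have hσ : 0 < CongestedClique.matMulExponent K + ε := by
    have := CongestedClique.two_le_matMulExponent K
    linarith
  obtain ⟨m, t, hm, ht, ⟨s⟩⟩ := CongestedClique.exists_rat_scheme K ε hε
  generalize CongestedClique.matMulExponent K + ε = σ at *
  obtain ⟨D, hD⟩ := s.exists_zmod
  -- Since p ≤ 2(9n + D) ≤ n(18 + 2D), a residue fits in half of these w messages and a pair of
  -- residues in all of them.
  set w := 2 * (1 + (18 + 2 * D)) with hw
  -- 33152 = 56 · 4 · 148, from the total of the rounds, `clog_le_log` and the bound on r.
  refine ⟨33152 * w * (m : ℝ) ^ 2, fun n M hM hMn => ?_⟩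
  -- For n = 1 the logarithm vanishes, so no round is available.
  obtain rfl | hn : n = 1 ∨ 2 ≤ n := by omega
  · obtain ⟨P, hP, hP'⟩ := CongestedClique.exists_protocol_one (Nat.clog 2 1) M
    exact ⟨P, hP, by simp [hP']⟩
  obtain ⟨j, hj, hj'⟩ := CongestedClique.exists_block_dimension hm hσ ht hM hMn
  obtain ⟨p, hp, hBp, hpB⟩ := Nat.exists_prime_lt_and_le_two_mul (9 * n + D) (by omega)
  have := Fact.mk hp
  obtain ⟨s'⟩ := hD p hp (by omega)
  obtain ⟨s''⟩ := s'.exists_pow j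
  set b := Nat.clog 2 n with hb
  have hb1 : 1 ≤ b := Nat.clog_pos (by norm_num) hn
  have hnb : n ≤ 2 ^ b := Nat.le_pow_clog (by norm_num) n
  have hpb : p ≤ 2 ^ (b * (1 + (18 + 2 * D))) := by
    calc p ≤ n * (18 + 2 * D) := by nlinarith
      _ ≤ 2 ^ b * 2 ^ (18 + 2 * D) := Nat.mul_le_mul hnb Nat.lt_two_pow_self.le
      _ = 2 ^ (b + (18 + 2 * D)) := (pow_add _ _ _).symm
      _ ≤ _ := Nat.pow_le_pow_right (by norm_num) (by nlinarith)
  have hpw : p * p ≤ 2 ^ (b * w) := by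
    rw [hw, show b * (2 * (1 + (18 + 2 * D))) = b * (1 + (18 + 2 * D)) + b * (1 + (18 + 2 * D)) by ring,
      pow_add]
    exact Nat.mul_le_mul hpb hpb
  obtain ⟨r, hr1, hr, hc⟩ := CongestedClique.exists_computes_minPlus s'' hM hMn
    (Nat.one_le_pow _ _ (by omega)) hj (by omega) hpw
  obtain ⟨P, hP, hPr⟩ := CongestedClique.exists_protocol_of_computes_minPlus (w := w) (by omega) hM hnb
    (by nlinarith) hc
  refine ⟨P, hP, ?_⟩
  have hR : P.rounds ≤ 56 * (b * (w * r)) := by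
    rw [hPr]
    have h1 : w ≤ w * r := Nat.le_mul_of_pos_right w hr1
    have h2 : w * r ≤ b * (w * r) := Nat.le_mul_of_pos_left _ hb1
    have h3 : b * w ≤ b * (w * r) := Nat.mul_le_mul_left _ h1
    nlinarith
  set X := (M : ℝ) ^ (2 / σ) * (n : ℝ) ^ (1 - 2 / σ)
  have hmj : (0 : ℝ) < ((m ^ j : ℕ) : ℝ) ^ 2 := by
    have : 0 < m ^ j := Nat.pow_pos (by omega)
    positivity
  have hrX : (r : ℝ) ≤ 148 * ((m : ℝ) ^ 2 * X) := by
    have h1 : (r : ℝ) * ((m ^ j : ℕ) : ℝ) ^ 2 ≤ 148 * n := by exact_mod_cast hr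
    refine le_of_mul_le_mul_right (h1.trans ?_) hmj
    calc 148 * (n : ℝ) ≤ 148 * ((m : ℝ) ^ 2 * ((m ^ j : ℕ) : ℝ) ^ 2 * X) := by gcongr
      _ = _ := by ring
  have hlog := CongestedClique.clog_le_log hn
  have hR' : (P.rounds : ℝ) ≤ 56 * (b * (w * r)) := by exact_mod_cast hR
  calc (P.rounds : ℝ) ≤ 56 * (b * (w * r)) := hR'
    _ ≤ 56 * ((4 * Real.log n) * (w * (148 * ((m : ℝ) ^ 2 * X)))) := by gcongr
    _ = _ := by ring
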